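/- **Model.** A secret from a finite set $\mathcal S$ is shared by a randomized dealer among $n$ players, each of whom gets one share; the dealer (whose randomness is discrete) is not active afterwards. The players then communicate in synchronous time steps over private point-to-point channels by sending bit strings to each other, and each player may at some time output an element of $\mathcal S$ as his guess of the secret; only the first output counts. No computational restriction is made. A deviating player may be *rushing*: in each time step he sees the messages that the others send to him in this step before he chooses his own. A player *learns the secret* in an outcome (the secret together with the final outputs of all players) if his final output is the secret; $R(\mathbf o)$ denotes the set of players who learn the secret in outcome $\mathbf o$. Each player $j$ has a utility function $u_j$ on outcomes that is *learning-preferring*: $u_j(\mathbf o)>u_j(\mathbf o')$ whenever $j\in R(\mathbf o)\setminus R(\mathbf o')$. Put $$U_j^+=\max_{j\in R(\mathbf o)}u_j(\mathbf o),\quad U_j=\min_{j\in R(\mathbf o)}u_j(\mathbf o),\quad U_j^-=\max_{j\notin R(\mathbf o)}u_j(\mathbf o),\quad \mathcal U(u)=\max_j\frac{U_j^+-U_j^-}{U_j-U_j^-}.$$ A protocol (a dealer and a prescribed strategy for each player) is an *$n$-out-of-$n$ secret sharing protocol in which all players learn the secret* if the joint distribution of the shares of any proper subset of the players does not depend on the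 secret and if, for every secret and with probability $1$, all players learn the secret when all follow the protocol. It is an *everlasting Nash equilibrium* for $u$ if, for a uniformly distributed secret, no player can increase his expected utility by deviating unilaterally, and the same remains true, for the conditional expected utility given all that the player has been dealt and has received (including, by rushing, the messages sent to him in the present time step), after every history that has positive probability when all players follow the protocol, for all deviations from that time step on. **Theorem 1.** For all real constants $\mathcal U\ge 1$ and $K$ there is a constant $C$ such that for all $n\ge 3$ and every finite set $\mathcal S$ with $\mathcal U<|\mathcal S|\le Kn$ there is an $n$-out-of-$n$ secret sharing protocol in which all players learn the secret, such that * the protocol is an everlasting Nash equilibrium for all learning-preferring utility functions $u$ with $\mathcal U(u)\le\mathcal U$; * when all players follow the protocol, for every secret, each player sends at most $C\log n$ bits in expectation, and the expected latency (the number of time steps until all players have output and no further message is sent) is at most $C\log n$. -/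

import Mathlib

open scoped ENNReal

namespace RationalSecretSharing

noncomputable section

/-- A message is a bit string. The empty string stands for sending nothing, so that every
message that is really sent costs at least one bit. -/
abbrev Msg : Type := List Bool

/-- What one player has received so far: the `t`-th entry lists the messages that reached the
player in time step `t`, one from every other player. -/
abbrev History (n : ℕ) : Type := List (Fin n → Msg)

/-- A strategy of one player: from the share dealt to the player and the messages received, it
determines the messages sent to the other players in the present time step and whether (and
which) guess of the secret is output. No computational restriction is made. -/
structure Strategy (n : ℕ) (S Share : Type) where
  send : Share → History n → Fin n → Msg
  output : Share → History n → Option S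

/-- A secret sharing protocol: a randomized dealer, who deals one share to each player and is
not active afterwards, and a prescribed strategy for each player. -/
structure Protocol (n : ℕ) (S : Type) where
  Share : Type
  deal : S → PMF (Fin n → Share)
  player : Fin n → Strategy n S Share

/-- An outcome of the game: the true secret and the final output of each player
(`none` if the player never outputs anything). -/
abbrev Outcome (n : ℕ) (S : Type) : Type := S × (Fin n → Option S)

/-- The players who learn the secret. -/
def learners {n : ℕ} {S : Type} (o : Outcome n S) : Set (Fin n) :=
  {j | o.2 j = some o.1}

/-! ### Utilities -/

/-- A utility function for each player. -/
abbrev Utility (n : ℕ) (S : Type) : Type := Fin n → Outcome n S → ℝ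

namespace Utility

variable {n : ℕ} {S : Type}

/-- Each player prefers every outcome in which he learns the secret to every outcome in which
he does not. -/
def LearningPreferring (u : Utility n S) : Prop :=
  ∀ (j : Fin n) (o o' : Outcome n S), j ∈ learners o → j ∉ learners o' → u j o' < u j o

/-- The best utility of `j` among the outcomes in which `j` learns the secret. -/
def bestLearning (u : Utility n S) (j : Fin n) : ℝ :=
  sSup (u j '' {o | j ∈ learners o})

/-- The worst utility of `j` among the outcomes in which `j` learns the secret. -/
def worstLearning (u : Utility n S) (j : Fin n) : ℝ :=
  sInf (u j '' {o | j ∈ learners o})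

/-- The best utility of `j` among the outcomes in which `j` does not learn the secret. -/
def bestNotLearning (u : Utility n S) (j : Fin n) : ℝ :=
  sSup (u j '' {o | j ∉ learners o})

/-- The maximum over the players `j` of `(U⁺ⱼ - U⁻ⱼ) / (Uⱼ - U⁻ⱼ)`. -/
def ratio (u : Utility n S) : ℝ :=
  ⨆ j : Fin n,
    (u.bestLearning j - u.bestNotLearning j) / (u.worstLearning j - u.bestNotLearning j)

end Utility

/-! ### Executions -/

/-- The messages that reach player `i` over the private channels from the other players, when
player `k` sends `m k l` to player `l`. -/
def incoming {n : ℕ} (m : Fin n → Fin n → Msg) (i : Fin n) : Fin n → Msg :=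
  fun k => if k = i then [] else m k i

open Classical in
/-- Outputs are final: only the first one counts. -/
def firstOutput {S : Type} (f : ℕ → Option S) : Option S :=
  if h : ∃ t, (f t).isSome then f (Nat.find h) else none

namespace Protocol

variable {n : ℕ} {S : Type} (P : Protocol n S)

/-- What each player has received before time step `t` when all players follow the protocol and
`x` is the vector of shares. -/
def hist (x : Fin n → P.Share) : ℕ → Fin n → History n
  | 0 => fun _ => []
  | t + 1 => fun i =>
      hist x t i ++ [incoming (fun k => (P.player k).send (x k) (hist x t k)) i]

/-- The message player `i` sends to player `k` in time step `t` when all players follow the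
protocol. -/
def sent (x : Fin n → P.Share) (t : ℕ) (i k : Fin n) : Msg :=
  (P.player i).send (x i) (P.hist x t i) k

/-- The output decision of player `i` after the first `t` time steps, when all follow. -/
def out (x : Fin n → P.Share) (i : Fin n) (t : ℕ) : Option S :=
  (P.player i).output (x i) (P.hist x t i)

/-- The outcome when all players follow the protocol. -/
def outcome (s : S) (x : Fin n → P.Share) : Outcome n S :=
  (s, fun i => firstOutput (P.out x i))

/-- What each player has received before time step `t` when player `j` plays `σ` and all others
follow the protocol. Player `j` is rushing: he chooses the messages of a time step after having
seen those that the others send to him in the same time step. -/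
def devHist (j : Fin n) (σ : Strategy n S P.Share) (x : Fin n → P.Share) :
    ℕ → Fin n → History n
  | 0 => fun _ => []
  | t + 1 => fun i =>
      let honest : Fin n → Fin n → Msg :=
        fun k => (P.player k).send (x k) (devHist j σ x t k)
      let seen : History n := devHist j σ x t j ++ [incoming honest j]
      devHist j σ x t i ++ [incoming (Function.update honest j (σ.send (x j) seen)) i]

/-- The outcome when player `j` plays the rushing strategy `σ` and all others follow. -/
def devOutcome (j : Fin n) (σ : Strategy n S P.Share) (s : S) (x : Fin n → P.Share) :
    Outcome n S :=
  (s, fun i => firstOutput fun t =>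
    (Function.update P.player j σ i).output (x i) (P.devHist j σ x t i))

/-- The rushing strategy of player `j` that follows the protocol in all time steps before `t`
and plays `σ` from time step `t` on. (A rushing player acts in time step `r` on a history of
length `r + 1`, whose last entry belongs to the present time step; the prescribed strategy makes
no use of that entry.) -/
def switchAt (j : Fin n) (t : ℕ) (σ : Strategy n S P.Share) : Strategy n S P.Share where
  send a h := if h.length ≤ t then (P.player j).send a h.dropLast else σ.send a h
  output a h := if h.length < t then (P.player j).output a h else σ.output a h

/-! ### Secret sharing -/

/-- Fewer than `n` of the shares reveal nothing about the secret: the joint distribution of the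
shares of any proper subset of the players does not depend on the secret. -/
def Secrecy : Prop :=
  ∀ T : Finset (Fin n), T ≠ Finset.univ → ∀ s s' : S,
    (P.deal s).map (fun x (i : T) => x i) = (P.deal s').map (fun x (i : T) => x i)

/-- Whatever the secret is, if all players follow the protocol then all of them learn it,
without any probability of error. -/
def AllLearn : Prop :=
  ∀ s : S, ∀ x ∈ (P.deal s).support, learners (P.outcome s x) = Set.univ

/-! ### Equilibria -/

/-- The expectation of `f (secret) (shares)` when the secret is uniformly distributed. -/
def expect [Fintype S] (f : S → (Fin n → P.Share) → ℝ) : ℝ :=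
  (∑ s : S, ∑' x : Fin n → P.Share, (P.deal s x).toReal * f s x) / Fintype.card S

/-- No player can gain in expectation by deviating unilaterally. (Deterministic deviations
suffice: the expected utility of a randomized one is an average of theirs.) -/
def IsNash [Fintype S] (u : Utility n S) : Prop :=
  ∀ (j : Fin n) (σ : Strategy n S P.Share),
    P.expect (fun s x => u j (P.devOutcome j σ s x)) ≤ P.expect (fun s x => u j (P.outcome s x))

/-- The event that, all players following the protocol, the share of player `j` is `a` and `j`
has received exactly `h`, as far as time step `t` and, by rushing, including time step `t`. -/
def View (j : Fin n) (t : ℕ) (a : P.Share) (h : History n) : Set (Fin n → P.Share) :=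
  {x | x j = a ∧ P.hist x (t + 1) j = h}

/-- The probability of that event. -/
def viewProb [Fintype S] (j : Fin n) (t : ℕ) (a : P.Share) (h : History n) : ℝ :=
  P.expect fun _ x => (P.View j t a h).indicator 1 x

/-- The conditional expectation of `f (secret) (shares)` given that event. -/
def condExpect [Fintype S] (j : Fin n) (t : ℕ) (a : P.Share) (h : History n)
    (f : S → (Fin n → P.Share) → ℝ) : ℝ :=
  P.expect (fun s x => (P.View j t a h).indicator (f s) x) / P.viewProb j t a h

/-- Following the protocol is a Nash equilibrium at the beginning, and it remains one after every
history that is consistent with all players following the protocol: whatever a player has been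
dealt and has received, his expected utility given all this does not increase if he deviates
from then on. -/
def IsEverlastingNash [Fintype S] (u : Utility n S) : Prop :=
  P.IsNash u ∧
    ∀ (j : Fin n) (t : ℕ) (a : P.Share) (h : History n), 0 < P.viewProb j t a h →
      ∀ σ : Strategy n S P.Share,
        P.condExpect j t a h (fun s x => u j (P.devOutcome j (P.switchAt j t σ) s x)) ≤
          P.condExpect j t a h (fun s x => u j (P.outcome s x))

/-! ### Costs -/

/-- The number of bits player `i` sends in the whole execution when all follow. -/
def bits (x : Fin n → P.Share) (i : Fin n) : ℝ≥0∞ :=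
  ∑' t : ℕ, ∑ k ∈ Finset.univ.erase i, ((P.sent x t i k).length : ℝ≥0∞)

/-- After `T` time steps all players have output something and no message is sent any more. -/
def Finished (x : Fin n → P.Share) (T : ℕ) : Prop :=
  (∀ i, ∃ t ≤ T, (P.out x i t).isSome) ∧ ∀ t ≥ T, ∀ i k, k ≠ i → P.sent x t i k = []

/-- The number of time steps until the execution is finished (infinite if it never is). -/
def latency (x : Fin n → P.Share) : ℝ≥0∞ :=
  ⨅ (T : ℕ) (_ : P.Finished x T), (T : ℝ≥0∞)

/-- The expected number of bits sent by player `i` when the secret is `s`. -/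
def expectedBits (s : S) (i : Fin n) : ℝ≥0∞ :=
  ∑' x : Fin n → P.Share, P.deal s x * P.bits x i

/-- The expected latency when the secret is `s`. -/
def expectedLatency (s : S) : ℝ≥0∞ :=
  ∑' x : Fin n → P.Share, P.deal s x * P.latency x

end Protocol

end

end RationalSecretSharing

/-!
The protocol hides the secret behind the time at which the execution stops. The dealer chooses a
random number `i` and shares the joint key `secret - i` (modulo the number `m` of secrets)
additively. He also gives each player an infinite sequence of symbols from `{0, 1, 2}`, where the
sequence depends on the player's class in a proper 3-colouring of a ring through all players. The
three sequences agree before time `i` and are pairwise different at time `i`.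

In the first phase the joint key is computed in time `O(log n)` by summation over a binary tree and
made known to everybody. In the second phase neighbours exchange their symbols one at a time, and a
player who receives something unexpected at the `t`-th symbol outputs `key + t` and is silent ever
after. If nobody deviates, this happens to all players at the time `t = i`, since each of them has a
ring neighbour of another class.

Why deviating does not pay:

* By construction of the sequences (`exists_splitLaw`), the conditional weights of the values of
  `i`, given the infinite sequence of any one player, decrease by a factor of at most `1 - η` per
  step, where `η` is of order `1 / log n`. So nobody can predict `i`, and yet the mean of `i` is
  `O(log n)`. Such sequences are found by starting with a random permutation of the three symbols
  and prefixing common symbols; a sequence may be exhausted (continue with zeros) with a small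
  probability, and the bookkeeping of two weights per step makes the marginals nondecreasing
  (`seqWeight_le_succ`), after which they are damped geometrically.
* Before the split, the deviator's view is the same as if all sequences were equal to his own
  (`SameUntil`), so that the first time `I` at which he makes an honest player stop does not depend
  on `i`. If `i < I`, all others learn the secret at the right time, and so nothing is gained
  (`gain_nonpos`). If `i ≥ I`, all honest players stop within `2 log n` steps, along the edges of
  the tree in which the deviator is a leaf (`spread`); for later `i` the deviator sees nothing that
  depends on `i`, and his output is right for one residue class of `i` modulo `m` only. As `m > U`
  and the weights are nearly flat, the expected gain is negative (`tsum_balance_le`).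
* In the first phase there are two trees, such that every player is a leaf in one of them, and all
  check that both give the same result. There a deviator can only change his own contribution. It
  is authenticated by a tag which his parent verifies; the tags are so long that guessing the key
  for another contribution almost always fails, and then the parent stops at once
  (`sum_gainBound_nonpos`).

The same argument applies on every event that the deviator can observe while he follows the
protocol (`observable_view`), because the events that matter depend on the symbols of the deviator
only and not on the unused parts of the authentication keys.
-/

namespace RationalSecretSharing

noncomputable section

/-! ### Executions with one deviator -/

/-- The message that reached the owner of the history `h` from player `k` in time step `t`
(the empty message if `h` is too short). -/
def received {n : ℕ} (h : History n) (t : ℕ) (k : Fin n) : Msg :=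
  h.getD t (fun _ => []) k

theorem received_append_left {n : ℕ} (h l : History n) {t : ℕ} (ht : t < h.length) (k : Fin n) :
    received (h ++ l) t k = received h t k := by
  unfold received
  rw [List.getD_append _ _ _ _ ht]

theorem received_append_singleton {n : ℕ} (h : History n) (e : Fin n → Msg) (k : Fin n) :
    received (h ++ [e]) h.length k = e k := by
  unfold received
  rw [List.getD_append_right _ _ _ _ le_rfl]
  simp

theorem firstOutput_eq {S : Type} {f : ℕ → Option S} {T : ℕ} {s : S}
    (h : ∀ t < T, f t = none) (hT : f T = some s) : firstOutput f = some s := by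
  classical
  have hex : ∃ t, (f t).isSome := ⟨T, by simp [hT]⟩
  have hfind : Nat.find hex = T := by
    rw [Nat.find_eq_iff]
    refine ⟨by simp [hT], fun t ht => by simp [h t ht]⟩
  unfold firstOutput
  rw [dif_pos hex]
  convert hT using 2

namespace Protocol

variable {n : ℕ} {S : Type} (P : Protocol n S)

/-- The message player `k` sends to player `l` in time step `t` when player `j` plays the rushing
strategy `σ` and all others follow the protocol. -/
def devSent (j : Fin n) (σ : Strategy n S P.Share) (x : Fin n → P.Share) (t : ℕ) (k l : Fin n) :
    Msg :=
  if k = j then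
    σ.send (x j) (P.devHist j σ x t j ++
      [incoming (fun k => (P.player k).send (x k) (P.devHist j σ x t k)) j]) l
  else (P.player k).send (x k) (P.devHist j σ x t k) l

/-- The rushing strategy that follows the protocol throughout. -/
def followDev (j : Fin n) : Strategy n S P.Share where
  send a h := (P.player j).send a h.dropLast
  output a h := (P.player j).output a h

variable {P} {j : Fin n} {σ : Strategy n S P.Share} {x : Fin n → P.Share}

theorem devHist_succ (t : ℕ) (i : Fin n) :
    P.devHist j σ x (t + 1) i = P.devHist j σ x t i ++ [incoming (P.devSent j σ x t) i] := by
  have : Function.update (fun k => (P.player k).send (x k) (P.devHist j σ x t k)) j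
      (σ.send (x j) (P.devHist j σ x t j ++
        [incoming (fun k => (P.player k).send (x k) (P.devHist j σ x t k)) j]))
      = P.devSent j σ x t := by
    funext k l
    by_cases hk : k = j
    · subst hk; simp [devSent]
    · simp [devSent, hk]
  rw [← this]
  rfl

theorem devSent_of_ne {k : Fin n} (hk : k ≠ j) (t : ℕ) (l : Fin n) :
    P.devSent j σ x t k l = (P.player k).send (x k) (P.devHist j σ x t k) l := by
  simp [devSent, hk]

@[simp] theorem length_devHist (t : ℕ) (i : Fin n) : (P.devHist j σ x t i).length = t := by
  induction t with
  | zero => rfl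
  | succ t ih => rw [devHist_succ]; simp [ih]

theorem received_devHist {t T : ℕ} (h : t < T) {i k : Fin n} (hk : k ≠ i) :
    received (P.devHist j σ x T i) t k = P.devSent j σ x t k i := by
  induction T with
  | zero => omega
  | succ T ih =>
    rw [devHist_succ]
    rcases Nat.lt_succ_iff_lt_or_eq.1 h with h' | rfl
    · rw [received_append_left _ _ (by simpa using h')]
      exact ih h'
    · have := received_append_singleton (P.devHist j σ x t i) (incoming (P.devSent j σ x t) i) k
      rw [length_devHist] at this
      rw [this]
      simp [incoming, hk]

/-- Two runs against the same deviating strategy agree as long as the honest players would send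
the same messages on the histories of the first run. -/
theorem devHist_congr {x' : Fin n → P.Share} {T : ℕ} (hj : x j = x' j)
    (hs : ∀ t < T, ∀ k, k ≠ j → ∀ l, (P.player k).send (x k) (P.devHist j σ x t k) l
      = (P.player k).send (x' k) (P.devHist j σ x t k) l) :
    ∀ t ≤ T, P.devHist j σ x t = P.devHist j σ x' t := by
  intro t ht
  induction t with
  | zero => rfl
  | succ t ih =>
    have ih := ih (by omega)
    have hin : incoming (fun k => (P.player k).send (x k) (P.devHist j σ x t k)) j
        = incoming (fun k => (P.player k).send (x' k) (P.devHist j σ x' t k)) j := by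
      funext k
      by_cases hk : k = j
      · simp [incoming, hk]
      · simp only [incoming, hk, if_false, ← ih]
        exact hs t (by omega) k hk j
    have hsent : P.devSent j σ x t = P.devSent j σ x' t := by
      funext k l
      by_cases hk : k = j
      · subst hk
        simp only [devSent, if_true, hin, ← ih, hj]
      · rw [devSent_of_ne hk, devSent_of_ne hk, ← ih]
        exact hs t (by omega) k hk l
    funext i
    rw [devHist_succ, devHist_succ, ih, hsent]

/-- A deviating strategy that sends what the protocol prescribes before time step `T` has no
influence on the histories of that time. -/
theorem devHist_eq_hist {T : ℕ}
    (hσ : ∀ h : History n, h.length ≤ T → σ.send (x j) h = (P.player j).send (x j) h.dropLast) :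
    ∀ t ≤ T, P.devHist j σ x t = P.hist x t := by
  intro t ht
  induction t with
  | zero => rfl
  | succ t ih =>
    have ih := ih (by omega)
    funext i
    rw [devHist_succ, ih]
    have : P.devSent j σ x t = fun k => (P.player k).send (x k) (P.hist x t k) := by
      funext k l
      by_cases hk : k = j
      · subst hk
        simp only [devSent, if_true]
        rw [hσ _ (by simpa using ht)]
        simp [ih]
      · rw [devSent_of_ne hk, ih]
    rw [this]
    rfl

theorem devHist_followDev (t : ℕ) : P.devHist j (P.followDev j) x t = P.hist x t :=
  devHist_eq_hist (T := t) (fun _ _ => rfl) t le_rfl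

theorem devSent_followDev (t : ℕ) (k l : Fin n) :
    P.devSent j (P.followDev j) x t k l = P.sent x t k l := by
  unfold devSent sent
  split_ifs with hk
  · subst hk
    rw [devHist_followDev]
    simp [followDev]
  · rw [devHist_followDev]

theorem received_hist {t T : ℕ} (h : t < T) {i k : Fin n} (hk : k ≠ i) :
    received (P.hist x T i) t k = P.sent x t k i := by
  rw [← devHist_followDev (j := i), received_devHist h hk, devSent_followDev]

theorem devHist_switchAt {T t : ℕ} (h : t ≤ T) :
    P.devHist j (P.switchAt j T σ) x t = P.hist x t :=
  devHist_eq_hist (T := T) (fun h hh => by funext l; simp [switchAt, hh]) t h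

theorem length_hist (t : ℕ) (i : Fin n) : (P.hist x t i).length = t := by
  rw [← devHist_followDev (j := i)]; simp

end Protocol

/-! ### Weights and their images -/

section Push

variable {X Y Z : Type}

open Classical in
/-- The image of a weight function under a map: the weight of `y` is the total weight of the
fibre over `y`. -/
def push (g : X → Y) (f : X → ℝ≥0∞) (y : Y) : ℝ≥0∞ :=
  ∑' x, if g x = y then f x else 0

theorem tsum_push (g : X → Y) (f : X → ℝ≥0∞) : ∑' y, push g f y = ∑' x, f x := by
  classical
  unfold push
  rw [ENNReal.tsum_comm]
  refine tsum_congr fun x => ?_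
  rw [tsum_eq_single (g x)]
  · simp
  · intro y hy; simp [hy.symm]

theorem push_push (g : Y → Z) (h : X → Y) (f : X → ℝ≥0∞) :
    push g (push h f) = push (fun x => g (h x)) f := by
  classical
  funext z
  unfold push
  have : ∀ y, (if g y = z then ∑' x, (if h x = y then f x else 0) else 0)
      = ∑' x, if h x = y then (if g y = z then f x else 0) else 0 := by
    intro y
    by_cases hy : g y = z <;> simp [hy]
  simp_rw [this]
  rw [ENNReal.tsum_comm]
  refine tsum_congr fun x => ?_
  rw [tsum_eq_single (h x)]
  · simp
  · intro y hy; simp [hy.symm]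

theorem push_mono (g : X → Y) {f f' : X → ℝ≥0∞} (hf : f ≤ f') : push g f ≤ push g f' := by
  classical
  intro y
  refine ENNReal.tsum_le_tsum fun x => ?_
  by_cases h : g x = y
  · simpa [h] using hf x
  · simp [h]

theorem push_add (g : X → Y) (f f' : X → ℝ≥0∞) : push g (f + f') = push g f + push g f' := by
  classical
  funext y
  simp only [push, Pi.add_apply]
  rw [← ENNReal.tsum_add]
  refine tsum_congr fun x => ?_
  by_cases h : g x = y <;> simp [h]

theorem push_smul (g : X → Y) (a : ℝ≥0∞) (f : X → ℝ≥0∞) : push g (a • f) = a • push g f := by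
  classical
  funext y
  simp only [push, Pi.smul_apply, smul_eq_mul]
  rw [← ENNReal.tsum_mul_left]
  refine tsum_congr fun x => ?_
  by_cases h : g x = y <;> simp [h]

theorem push_sum {ι : Type} (s : Finset ι) (g : X → Y) (f : ι → X → ℝ≥0∞) :
    push g (∑ k ∈ s, f k) = ∑ k ∈ s, push g (f k) := by
  classical
  induction s using Finset.induction_on with
  | empty => funext y; simp [push]
  | insert a s ha ih => rw [Finset.sum_insert ha, Finset.sum_insert ha, push_add, ih]

theorem push_tsum (g : X → Y) (f : ℕ → X → ℝ≥0∞) :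
    push g (fun x => ∑' k, f k x) = fun y => ∑' k, push g (f k) y := by
  classical
  funext y
  unfold push
  rw [ENNReal.tsum_comm]
  refine tsum_congr fun x => ?_
  by_cases h : g x = y <;> simp [h]

theorem exists_of_push_ne_zero {g : X → Y} {f : X → ℝ≥0∞} {y : Y} (h : push g f y ≠ 0) :
    ∃ x, g x = y ∧ f x ≠ 0 := by
  classical
  by_contra hcon
  push Not at hcon
  refine h ?_
  unfold push
  rw [ENNReal.tsum_eq_zero]
  intro x
  by_cases hx : g x = y
  · simpa [hx] using hcon x hx
  · simp [hx]

open Classical in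
/-- The unit weight at a point. -/
def unitAt (a : X) : X → ℝ≥0∞ := fun x => if x = a then 1 else 0

theorem push_const (a : Y) (f : X → ℝ≥0∞) : push (fun _ => a) f = (∑' x, f x) • unitAt a := by
  classical
  funext y
  by_cases h : a = y
  · simp [push, unitAt, h]
  · simp [push, unitAt, h, Ne.symm h]

theorem push_unitAt (g : X → Y) (a : X) : push g (unitAt a) = unitAt (g a) := by
  classical
  funext y
  unfold push unitAt
  rw [tsum_eq_single a]
  · by_cases h : g a = y
    · simp [h]
    · simp [h, Ne.symm h]
  · intro x hx; simp [hx]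

theorem tsum_unitAt (a : X) : ∑' x, unitAt a x = 1 := by
  classical
  unfold unitAt
  simp

end Push

/-! ### Symbol sequences -/

/-- A sequence of symbols. -/
abbrev SymSeq : Type := ℕ → Fin 3

/-- Three sequences of symbols, one for each class of players. -/
abbrev SeqTriple : Type := Fin 3 → SymSeq

/-- The sequence with first symbol `b` and remainder `l`. -/
def consSeq (b : Fin 3) (l : SymSeq) : SymSeq
  | 0 => b
  | i + 1 => l i

/-- Three sequences get the same first symbol `b`. -/
def consTriple (b : Fin 3) (t : SeqTriple) : SeqTriple := fun c => consSeq b (t c)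

/-- Like `consSeq b l`, but with first symbol `0` the sequence is exhausted. -/
def consOrZero (b : Fin 3) (l : SymSeq) : SymSeq := if b = 0 then 0 else consSeq b l

@[simp] theorem consOrZero_zero (b : Fin 3) (l : SymSeq) : consOrZero b l 0 = b := by
  by_cases hb : b = 0 <;> simp [consOrZero, consSeq, hb]

theorem consSeq_zero_zero : consSeq 0 0 = 0 := by
  funext i; cases i <;> rfl

/-- Uniformly distributed symbols for `k` steps, and zeros afterwards. -/
def uniformPrefix : ℕ → SymSeq → ℝ≥0∞
  | 0 => unitAt 0
  | k + 1 => (3⁻¹ : ℝ≥0∞) • ∑ b : Fin 3, push (consSeq b) (uniformPrefix k)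

theorem tsum_sum_push {X Y : Type} (g : Fin 3 → X → Y) (f : X → ℝ≥0∞) :
    ∑' y, (∑ b : Fin 3, push (g b) f) y = 3 * ∑' x, f x := by
  simp only [Finset.sum_apply]
  rw [Summable.tsum_finsetSum (fun _ _ => ENNReal.summable)]
  simp [tsum_push]

theorem tsum_smul_fun {X : Type} (a : ℝ≥0∞) (f : X → ℝ≥0∞) :
    ∑' x, (a • f) x = a * ∑' x, f x := by
  simp [ENNReal.tsum_mul_left]

theorem tsum_add_fun {X : Type} (f g : X → ℝ≥0∞) :
    ∑' x, (f + g) x = ∑' x, f x + ∑' x, g x := by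
  simp [ENNReal.tsum_add]

theorem tsum_uniformPrefix (k : ℕ) : ∑' l, uniformPrefix k l = 1 := by
  induction k with
  | zero => exact tsum_unitAt _
  | succ k ih =>
    unfold uniformPrefix
    rw [tsum_smul_fun, tsum_sum_push, ih, mul_one]
    exact ENNReal.inv_mul_cancel (by norm_num) (by norm_num)

section Law

variable (a e : ℝ≥0∞)

/-- Uniformly distributed symbols up to a random time that is geometrically distributed (the
sequence is exhausted with probability `e` in each step, and `a = 1 - e`), and zeros afterwards. -/
def tailWeight (l : SymSeq) : ℝ≥0∞ := ∑' k, (e * a ^ k) * uniformPrefix k l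

theorem tailWeight_eq :
    tailWeight a e = e • unitAt 0 +
      a • ((3⁻¹ : ℝ≥0∞) • ∑ b : Fin 3, push (consSeq b) (tailWeight a e)) := by
  funext l
  have h1 : ∀ b : Fin 3, push (consSeq b) (tailWeight a e)
      = fun l => ∑' k, (e * a ^ k) * push (consSeq b) (uniformPrefix k) l := by
    intro b
    have := push_tsum (consSeq b) (fun k => (e * a ^ k) • uniformPrefix k)
    simp only [push_smul] at this
    exact this
  simp only [h1]
  conv_lhs => unfold tailWeight
  rw [tsum_eq_zero_add' ENNReal.summable]
  simp only [Pi.add_apply, Pi.smul_apply, smul_eq_mul, Finset.sum_apply, pow_zero, mul_one]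
  congr 1
  rw [← Summable.tsum_finsetSum (fun _ _ => ENNReal.summable), ← mul_assoc,
    ← ENNReal.tsum_mul_left]
  refine tsum_congr fun k => ?_
  conv_lhs => unfold uniformPrefix
  simp only [Pi.smul_apply, smul_eq_mul, Finset.sum_apply, Finset.mul_sum, pow_succ]
  refine Finset.sum_congr rfl fun b _ => ?_
  ring

variable {a e}

theorem tsum_tailWeight (hae : a + e = 1) (he : e ≠ 0) : ∑' l, tailWeight a e l = 1 := by
  unfold tailWeight
  rw [ENNReal.tsum_comm]
  simp_rw [ENNReal.tsum_mul_left, tsum_uniformPrefix, mul_one]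
  rw [ENNReal.tsum_mul_left, ENNReal.tsum_geometric]
  have ha : a ≠ ∞ := by
    rintro rfl; simp at hae
  have : 1 - a = e := by
    rw [← hae]; exact ENNReal.add_sub_cancel_left ha
  rw [this]
  exact ENNReal.mul_inv_cancel he (by rintro rfl; simp at hae)

variable (a e)

/-- The two components evolve as long as the sequences are equal: a sequence that is not yet
exhausted continues with a uniform symbol, an exhausted one with `0`; in the latter case sequences
that continue with another symbol are added, so that all symbols keep the same weight. -/
def stepWeight {X : Type} (cons : Fin 3 → X → X) (f : (X → ℝ≥0∞) × (X → ℝ≥0∞)) :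
    (X → ℝ≥0∞) × (X → ℝ≥0∞) :=
  ((3⁻¹ : ℝ≥0∞) • ∑ b : Fin 3, push (cons b) (a • f.1 + e • f.2),
    push (cons 0) f.2 + ∑ b ∈ ({1, 2} : Finset (Fin 3)), push (cons b) (a • f.1 + e • f.2))

/-- Three sequences whose first symbols form a random permutation of the three symbols. In the
second component the sequence with first symbol `0` is exhausted. -/
def splitWeight : (SeqTriple → ℝ≥0∞) × (SeqTriple → ℝ≥0∞) :=
  ((3⁻¹ : ℝ≥0∞) • ∑ k : Fin 3, push (fun l c => consSeq (c + k) l) (tailWeight a e),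
    ∑ k : Fin 3, push (fun l c => consOrZero (c + k) l) (tailWeight a e))

/-- The weights of three sequences that are equal before time `i` and pairwise different at
time `i`; the first component is the one of interest, the second one belongs to a history in which
the sequence of some class is exhausted. -/
def tripleWeight : ℕ → (SeqTriple → ℝ≥0∞) × (SeqTriple → ℝ≥0∞)
  | 0 => splitWeight a e
  | i + 1 => stepWeight a e consTriple (tripleWeight i)

/-- The weights of the sequence of class `c`. -/
def seqWeight (c : Fin 3) (i : ℕ) : (SymSeq → ℝ≥0∞) × (SymSeq → ℝ≥0∞) :=
  (push (fun t => t c) (tripleWeight a e i).1, push (fun t => t c) (tripleWeight a e i).2)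

theorem seqWeight_succ (c : Fin 3) (i : ℕ) :
    seqWeight a e c (i + 1) = stepWeight a e consSeq (seqWeight a e c i) := by
  have h : ∀ (b : Fin 3) (f : SeqTriple → ℝ≥0∞),
      push (fun t => t c) (push (consTriple b) f) = push (consSeq b) (push (fun t => t c) f) := by
    intro b f
    rw [push_push, push_push]
    rfl
  unfold seqWeight
  simp only [tripleWeight, stepWeight, push_smul, push_sum, push_add, h]

theorem seqWeight_zero_fst (c : Fin 3) :
    (seqWeight a e c 0).1 = (3⁻¹ : ℝ≥0∞) • ∑ b : Fin 3, push (consSeq b) (tailWeight a e) := by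
  simp only [seqWeight, tripleWeight, splitWeight, push_smul, push_sum, push_push]
  congr 1
  exact Equiv.sum_comp (Equiv.addLeft c) (fun b => push (consSeq b) (tailWeight a e))

variable {a e}

theorem seqWeight_zero_snd (hae : a + e = 1) (he : e ≠ 0) (c : Fin 3) :
    (seqWeight a e c 0).2
      = unitAt 0 + ∑ b ∈ ({1, 2} : Finset (Fin 3)), push (consSeq b) (tailWeight a e) := by
  simp only [seqWeight, tripleWeight, splitWeight, push_sum, push_push]
  have hperm := Equiv.sum_comp (Equiv.addLeft c)
    (fun b => push (fun l => consOrZero b l) (tailWeight a e))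
  simp only [Equiv.coe_addLeft] at hperm
  rw [hperm, Fin.sum_univ_three]
  have h0 : (fun l => consOrZero 0 l) = fun _ => 0 := by funext l; simp [consOrZero]
  have h1 : (fun l => consOrZero 1 l) = consSeq 1 := by funext l; simp [consOrZero]
  have h2 : (fun l => consOrZero 2 l) = consSeq 2 := by funext l; simp [consOrZero]
  rw [Finset.sum_pair (by decide)]
  simp only [h0, h1, h2, push_const, tsum_tailWeight hae he, one_smul, add_assoc]

theorem stepWeight_mono {X : Type} (cons : Fin 3 → X → X) {f g : (X → ℝ≥0∞) × (X → ℝ≥0∞)}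
    (h : f ≤ g) : stepWeight a e cons f ≤ stepWeight a e cons g := by
  have hm : a • f.1 + e • f.2 ≤ a • g.1 + e • g.2 := by
    intro x
    simp only [Pi.add_apply, Pi.smul_apply, smul_eq_mul]
    gcongr
    · exact h.1 x
    · exact h.2 x
  have hs : ∀ s : Finset (Fin 3), ∑ b ∈ s, push (cons b) (a • f.1 + e • f.2)
      ≤ ∑ b ∈ s, push (cons b) (a • g.1 + e • g.2) :=
    fun s => Finset.sum_le_sum fun b _ => push_mono _ hm
  refine ⟨fun x => ?_, add_le_add (push_mono _ h.2) (hs _)⟩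
  simp only [stepWeight, Pi.smul_apply, smul_eq_mul]
  gcongr
  exact hs _ x

/-- The weight of each fixed sequence does not decrease when the time of the split is postponed.
This is what makes the time of the split almost unpredictable to the owner of the sequence. -/
theorem seqWeight_le_succ (hae : a + e = 1) (he : e ≠ 0) (c : Fin 3) (i : ℕ) :
    seqWeight a e c i ≤ seqWeight a e c (i + 1) := by
  induction i with
  | succ i ih =>
    rw [seqWeight_succ, seqWeight_succ a e c (i + 1)]
    exact stepWeight_mono _ ih
  | zero =>
    -- the exhausted sequence is one of those the second component starts with
    have hT : tailWeight a e ≤ a • (seqWeight a e c 0).1 + e • (seqWeight a e c 0).2 := by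
      conv_lhs => rw [tailWeight_eq]
      rw [seqWeight_zero_fst, add_comm, seqWeight_zero_snd hae he, smul_add, ← add_assoc]
      exact le_self_add
    have hs : ∀ s : Finset (Fin 3), ∑ b ∈ s, push (consSeq b) (tailWeight a e)
        ≤ ∑ b ∈ s, push (consSeq b) (a • (seqWeight a e c 0).1 + e • (seqWeight a e c 0).2) :=
      fun s => Finset.sum_le_sum fun b _ => push_mono _ hT
    rw [seqWeight_succ]
    refine ⟨fun x => ?_, ?_⟩
    · rw [seqWeight_zero_fst]
      simp only [stepWeight, Pi.smul_apply, smul_eq_mul]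
      gcongr
      exact hs _ x
    · conv_lhs => rw [seqWeight_zero_snd hae he]
      refine add_le_add ?_ (hs _)
      rw [seqWeight_zero_snd hae he, push_add, push_unitAt, consSeq_zero_zero]
      exact le_self_add

theorem tripleWeight_support (i : ℕ) (t : SeqTriple)
    (h : (tripleWeight a e i).1 t ≠ 0 ∨ (tripleWeight a e i).2 t ≠ 0) :
    (∀ i' < i, ∀ c c', t c i' = t c' i') ∧ ∀ c c', c ≠ c' → t c i ≠ t c' i := by
  induction i generalizing t with
  | zero =>
    refine ⟨by simp, fun c c' hc => ?_⟩
    simp only [tripleWeight, splitWeight, Pi.smul_apply, smul_eq_mul, Finset.sum_apply, ne_eq,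
      mul_eq_zero, not_or] at h
    have key : ∃ k : Fin 3, ∀ c, t c 0 = c + k := by
      rcases h with ⟨-, h⟩ | h
      · obtain ⟨k, -, hk⟩ := Finset.exists_ne_zero_of_sum_ne_zero h
        obtain ⟨l, rfl, -⟩ := exists_of_push_ne_zero hk
        exact ⟨k, fun c => rfl⟩
      · obtain ⟨k, -, hk⟩ := Finset.exists_ne_zero_of_sum_ne_zero h
        obtain ⟨l, rfl, -⟩ := exists_of_push_ne_zero hk
        exact ⟨k, fun c => consOrZero_zero _ _⟩
    obtain ⟨k, hk⟩ := key
    rw [hk, hk]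
    simpa using hc
  | succ i ih =>
    have key : ∃ (b : Fin 3) (t' : SeqTriple), t = consTriple b t' ∧
        ((tripleWeight a e i).1 t' ≠ 0 ∨ (tripleWeight a e i).2 t' ≠ 0) := by
      have hm : ∀ b t, push (consTriple b)
          (a • (tripleWeight a e i).1 + e • (tripleWeight a e i).2) t ≠ 0 →
          ∃ (b : Fin 3) (t' : SeqTriple), t = consTriple b t' ∧
            ((tripleWeight a e i).1 t' ≠ 0 ∨ (tripleWeight a e i).2 t' ≠ 0) := by
        intro b t h
        obtain ⟨t', rfl, h'⟩ := exists_of_push_ne_zero h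
        refine ⟨b, t', rfl, ?_⟩
        by_contra hcon
        push Not at hcon
        simp [hcon] at h'
      simp only [tripleWeight, stepWeight, Pi.smul_apply, smul_eq_mul, Finset.sum_apply, ne_eq,
        mul_eq_zero, not_or, Pi.add_apply, add_eq_zero, not_and_or] at h
      rcases h with ⟨-, h⟩ | h | h
      · obtain ⟨k, -, hk⟩ := Finset.exists_ne_zero_of_sum_ne_zero h
        exact hm _ _ hk
      · obtain ⟨t', rfl, h'⟩ := exists_of_push_ne_zero h
        exact ⟨0, t', rfl, Or.inr h'⟩
      · obtain ⟨k, -, hk⟩ := Finset.exists_ne_zero_of_sum_ne_zero h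
        exact hm _ _ hk
    obtain ⟨b, t', rfl, h'⟩ := key
    obtain ⟨h1, h2⟩ := ih t' h'
    refine ⟨fun i' hi' c c' => ?_, fun c c' hc => ?_⟩
    · cases i' with
      | zero => rfl
      | succ i' => exact h1 i' (by omega) c c'
    · exact h2 c c' hc

theorem tsum_tripleWeight_succ (i : ℕ) :
    ∑' t, (tripleWeight a e (i + 1)).1 t
        = a * ∑' t, (tripleWeight a e i).1 t + e * ∑' t, (tripleWeight a e i).2 t ∧
      ∑' t, (tripleWeight a e (i + 1)).2 t = ∑' t, (tripleWeight a e i).2 t +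
        2 * (a * ∑' t, (tripleWeight a e i).1 t + e * ∑' t, (tripleWeight a e i).2 t) := by
  constructor
  · simp only [tripleWeight, stepWeight]
    rw [tsum_smul_fun, tsum_sum_push, tsum_add_fun, tsum_smul_fun, tsum_smul_fun, ← mul_assoc,
      ENNReal.inv_mul_cancel (by norm_num) (by norm_num), one_mul]
  · simp only [tripleWeight, stepWeight]
    rw [tsum_add_fun, tsum_push, Finset.sum_pair (by decide), tsum_add_fun, tsum_push, tsum_push,
      tsum_add_fun, tsum_smul_fun, tsum_smul_fun, two_mul]

theorem tsum_tripleWeight_zero (hae : a + e = 1) (he : e ≠ 0) :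
    ∑' t, (tripleWeight a e 0).1 t = 1 ∧ ∑' t, (tripleWeight a e 0).2 t = 3 := by
  constructor
  · simp only [tripleWeight, splitWeight]
    rw [tsum_smul_fun, tsum_sum_push, tsum_tailWeight hae he, mul_one]
    exact ENNReal.inv_mul_cancel (by norm_num) (by norm_num)
  · simp only [tripleWeight, splitWeight]
    rw [tsum_sum_push, tsum_tailWeight hae he, mul_one]

theorem one_le_tsum_tripleWeight (hae : a + e = 1) (he : e ≠ 0) (i : ℕ) :
    1 ≤ ∑' t, (tripleWeight a e i).1 t := by
  have h : ∀ i, ∑' t, (tripleWeight a e i).1 t = ∑' l, (seqWeight a e 0 i).1 l :=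
    fun i => (tsum_push _ _).symm
  induction i with
  | zero => rw [(tsum_tripleWeight_zero hae he).1]
  | succ i ih =>
    refine ih.trans ?_
    rw [h, h]
    exact ENNReal.tsum_le_tsum fun l => (seqWeight_le_succ hae he 0 i).1 l

/-- With `e = x ^ 2` the total weight grows by a factor of at most `1 + 2 x` per step. -/
theorem tsum_tripleWeight_le {x : ℝ≥0∞} (hae : a + x * x = 1) (hx0 : x ≠ 0) (hx : 2 * x ≤ 1)
    (i : ℕ) : ∑' t, (tripleWeight a (x * x) i).1 t ≤ (1 + 3 * x) * (1 + 2 * x) ^ i := by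
  have he : x * x ≠ 0 := mul_ne_zero hx0 hx0
  suffices h : ∑' t, (tripleWeight a (x * x) i).1 t + x * ∑' t, (tripleWeight a (x * x) i).2 t
      ≤ (1 + 3 * x) * (1 + 2 * x) ^ i from le_self_add.trans h
  induction i with
  | zero =>
    obtain ⟨h1, h2⟩ := tsum_tripleWeight_zero hae he
    rw [h1, h2, pow_zero, mul_one, mul_comm]
  | succ i ih =>
    obtain ⟨h1, h2⟩ := tsum_tripleWeight_succ (a := a) (e := x * x) i
    rw [h1, h2]
    set p := ∑' t, (tripleWeight a (x * x) i).1 t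
    set q := ∑' t, (tripleWeight a (x * x) i).2 t
    have ha : a ≤ 1 := by rw [← hae]; exact le_self_add
    calc a * p + x * x * q + x * (q + 2 * (a * p + x * x * q))
        ≤ 1 * p + x * x * q + x * (q + 2 * (1 * p + x * x * q)) := by gcongr
      _ = (1 + 2 * x) * p + x * q + x * x * q * (1 + 2 * x) := by ring
      _ ≤ (1 + 2 * x) * p + x * q + x * x * q * (1 + 1) := by gcongr
      _ = (1 + 2 * x) * (p + x * q) := by ring
      _ ≤ (1 + 2 * x) * ((1 + 3 * x) * (1 + 2 * x) ^ i) := by gcongr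
      _ = (1 + 3 * x) * (1 + 2 * x) ^ (i + 1) := by ring

end Law

/-- The law of the hidden data that decide when the protocol stops: a time `i` and three sequences
that are equal before time `i` and pairwise different at time `i`. Given any one of the sequences,
the probability that the split takes place at time `i` decreases by a factor of at most `1 - η`
per step, for ever. -/
theorem exists_splitLaw {η : ℝ} (h0 : 0 < η) (h1 : η ≤ 1) :
    ∃ law : PMF (ℕ × SeqTriple),
      (∀ L ∈ law.support, (∀ i < L.1, ∀ c c', L.2 c i = L.2 c' i) ∧
        ∀ c c', c ≠ c' → L.2 c L.1 ≠ L.2 c' L.1) ∧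
      (∀ c l i, ENNReal.ofReal (1 - η) * law.map (fun L => (L.2 c, L.1)) (l, i)
        ≤ law.map (fun L => (L.2 c, L.1)) (l, i + 1)) ∧
      ∑' L, law L * L.1 ≤ ENNReal.ofReal (8 / η) := by
  classical
  -- exhaustion with probability `x ^ 2` makes the total weight grow by `1 + 2 x` per step, which is
  -- less than the damping by `1 - η` makes up for
  set x : ℝ≥0∞ := ENNReal.ofReal (η / 4) with hxdef
  set a : ℝ≥0∞ := ENNReal.ofReal (1 - η / 4 * (η / 4)) with hadef
  set y : ℝ≥0∞ := ENNReal.ofReal (1 - η) with hydef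
  have hx0 : x ≠ 0 := by simp [x, h0]
  have he0 : x * x ≠ 0 := mul_ne_zero hx0 hx0
  have hae : a + x * x = 1 := by
    rw [hxdef, hadef, ← ENNReal.ofReal_mul (by positivity), ← ENNReal.ofReal_add (by nlinarith)
      (by positivity)]
    simp
  have hx2 : 2 * x ≤ 1 := by
    rw [hxdef, show (2 : ℝ≥0∞) = ENNReal.ofReal 2 by simp, ← ENNReal.ofReal_mul (by norm_num)]
    exact ENNReal.ofReal_le_one.2 (by linarith)
  set F : ℕ × SeqTriple → ℝ≥0∞ := fun L => y ^ L.1 * (tripleWeight a (x * x) L.1).1 L.2 with hF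
  set p : ℕ → ℝ≥0∞ := fun i => ∑' t, (tripleWeight a (x * x) i).1 t with hp
  have hsum : ∀ g : ℕ → ℝ≥0∞, ∑' L, F L * g L.1 = ∑' i, y ^ i * p i * g i := by
    intro g
    rw [ENNReal.tsum_prod']
    refine tsum_congr fun i => ?_
    simp only [hF, hp]
    rw [ENNReal.tsum_mul_right, ENNReal.tsum_mul_left]
  -- the total weight lies between `1 / η` and a convergent geometric series
  set w : ℝ := 1 - η / 2 with hw
  have hpw : ∀ i, y ^ i * p i ≤ ENNReal.ofReal (2 * w ^ i) := by
    intro i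
    have hb : y * (1 + 2 * x) ≤ ENNReal.ofReal w := by
      rw [hydef, hxdef, show (2 : ℝ≥0∞) = ENNReal.ofReal 2 by simp,
        ← ENNReal.ofReal_mul (by norm_num), ← ENNReal.ofReal_one,
        ← ENNReal.ofReal_add (by norm_num) (by positivity), ← ENNReal.ofReal_mul (by linarith)]
      exact ENNReal.ofReal_le_ofReal (by rw [hw]; nlinarith)
    have h3 : 1 + 3 * x ≤ ENNReal.ofReal 2 := by
      rw [hxdef, show (3 : ℝ≥0∞) = ENNReal.ofReal 3 by simp,
        ← ENNReal.ofReal_mul (by norm_num), ← ENNReal.ofReal_one,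
        ← ENNReal.ofReal_add (by norm_num) (by positivity)]
      exact ENNReal.ofReal_le_ofReal (by linarith)
    calc y ^ i * p i ≤ y ^ i * ((1 + 3 * x) * (1 + 2 * x) ^ i) := by
          gcongr; exact tsum_tripleWeight_le hae hx0 hx2 i
      _ = (1 + 3 * x) * (y * (1 + 2 * x)) ^ i := by rw [mul_pow]; ring
      _ ≤ ENNReal.ofReal 2 * ENNReal.ofReal w ^ i := by gcongr
      _ = ENNReal.ofReal (2 * w ^ i) := by
          rw [ENNReal.ofReal_mul (by norm_num), ENNReal.ofReal_pow (by linarith)]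
  have hw0 : 0 ≤ w := by linarith
  have hw1 : w < 1 := by linarith
  have hF_one := hsum (fun _ => 1)
  simp only [mul_one] at hF_one
  have hZle : ENNReal.ofReal (1 / η) ≤ ∑' L, F L := by
    rw [hF_one]
    calc ENNReal.ofReal (1 / η) = ∑' i, y ^ i := by
          rw [ENNReal.tsum_geometric, hydef, ← ENNReal.ofReal_one,
            ← ENNReal.ofReal_sub _ (by linarith), ← ENNReal.ofReal_inv_of_pos (by linarith)]
          congr 1; rw [sub_sub_cancel, one_div]
      _ ≤ _ := ENNReal.tsum_le_tsum fun i => by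
          conv_lhs => rw [← mul_one (y ^ i)]
          gcongr
          exact one_le_tsum_tripleWeight hae he0 i
  have hZ0 : ∑' L, F L ≠ 0 := by
    intro h
    rw [h] at hZle
    have : 0 < 1 / η := by positivity
    simp at hZle
    linarith
  have hZtop : ∑' L, F L ≠ ∞ := by
    rw [hF_one]
    refine ne_top_of_le_ne_top ?_ (ENNReal.tsum_le_tsum hpw)
    rw [← ENNReal.ofReal_tsum_of_nonneg (fun i => by positivity)
      ((summable_geometric_of_lt_one hw0 hw1).mul_left 2)]
    exact ENNReal.ofReal_ne_top
  refine ⟨PMF.normalize F hZ0 hZtop, fun L hL => ?_, fun c l i => ?_, ?_⟩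
  · rw [PMF.mem_support_normalize_iff] at hL
    exact tripleWeight_support (a := a) (e := x * x) L.1 L.2 (Or.inl (right_ne_zero_of_mul hL))
  · have hmap : ∀ i, (PMF.normalize F hZ0 hZtop).map (fun L => (L.2 c, L.1)) (l, i)
        = y ^ i * (seqWeight a (x * x) c i).1 l * (∑' L, F L)⁻¹ := by
      intro i
      rw [PMF.map_apply, ENNReal.tsum_prod', tsum_eq_single i]
      · simp only [PMF.normalize_apply, seqWeight, push, Prod.mk.injEq, and_true]
        rw [← ENNReal.tsum_mul_left, ← ENNReal.tsum_mul_right]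
        refine tsum_congr fun t => ?_
        by_cases h : t c = l
        · simp [h, hF]
        · simp [h, Ne.symm h]
      · intro i' hi'
        simp [hi'.symm]
    rw [hmap, hmap, ← mul_assoc, ← mul_assoc, ← pow_succ']
    gcongr
    exact (seqWeight_le_succ hae he0 c i).1 l
  · simp only [PMF.normalize_apply]
    have : ∀ L : ℕ × SeqTriple, F L * (∑' L, F L)⁻¹ * (L.1 : ℝ≥0∞)
        = (F L * (L.1 : ℝ≥0∞)) * (∑' L, F L)⁻¹ := fun L => by ring
    simp_rw [this]
    rw [ENNReal.tsum_mul_right, hsum (fun i => (i : ℝ≥0∞))]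
    have hnum : ∑' i, y ^ i * p i * (i : ℝ≥0∞) ≤ ENNReal.ofReal (8 / η ^ 2) := by
      have hs := hasSum_coe_mul_geometric_of_norm_lt_one (𝕜 := ℝ) (r := w)
        (by rw [Real.norm_eq_abs, abs_of_nonneg hw0]; exact hw1)
      calc ∑' i, y ^ i * p i * (i : ℝ≥0∞) ≤ ∑' i : ℕ, ENNReal.ofReal (2 * (i * w ^ i)) := by
            refine ENNReal.tsum_le_tsum fun i => ?_
            calc y ^ i * p i * (i : ℝ≥0∞) ≤ ENNReal.ofReal (2 * w ^ i) * ENNReal.ofReal i := by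
                  rw [ENNReal.ofReal_natCast]; gcongr; exact hpw i
              _ = _ := by
                  rw [← ENNReal.ofReal_mul (by positivity)]; congr 1; ring
        _ = ENNReal.ofReal (2 * (w / (1 - w) ^ 2)) := by
            rw [← ENNReal.ofReal_tsum_of_nonneg (fun i => by positivity) (hs.summable.mul_left 2),
              tsum_mul_left, hs.tsum_eq]
        _ ≤ _ := by
            refine ENNReal.ofReal_le_ofReal ?_
            rw [show 1 - w = η / 2 by rw [hw]; ring]
            rw [show 2 * (w / (η / 2) ^ 2) = 8 * w / η ^ 2 by field_simp; ring]
            gcongr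
            linarith
    calc _ ≤ ENNReal.ofReal (8 / η ^ 2) * (ENNReal.ofReal (1 / η))⁻¹ := by gcongr
      _ = ENNReal.ofReal (8 / η) := by
          rw [← ENNReal.ofReal_inv_of_pos (by positivity), ← ENNReal.ofReal_mul (by positivity)]
          congr 1; field_simp

/-! ### Slowly decreasing weights -/

/-- Nonnegative summable weights that decrease by a factor of at most `1 - η` per step. -/
structure SlowlyDecreasing (η : ℝ) (W : ℕ → ℝ) : Prop where
  nonneg : ∀ i, 0 ≤ W i
  summable : Summable W
  slow : ∀ i, (1 - η) * W i ≤ W (i + 1)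

namespace SlowlyDecreasing

variable {η : ℝ} {W : ℕ → ℝ}

theorem summable_ite (hW : SlowlyDecreasing η W) (p : ℕ → Prop) [DecidablePred p] :
    Summable fun i => if p i then W i else 0 := by
  refine Summable.of_nonneg_of_le (fun i => ?_) (fun i => ?_) hW.summable
  · split_ifs
    exacts [hW.nonneg i, le_rfl]
  · split_ifs
    exacts [le_rfl, hW.nonneg i]

theorem pow_mul_le (hW : SlowlyDecreasing η W) (h1 : η ≤ 1) (i k : ℕ) :
    (1 - η) ^ k * W i ≤ W (i + k) := by
  induction k with
  | zero => simp
  | succ k ih =>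
    calc (1 - η) ^ (k + 1) * W i = (1 - η) * ((1 - η) ^ k * W i) := by ring
      _ ≤ (1 - η) * W (i + k) := mul_le_mul_of_nonneg_left ih (by linarith)
      _ ≤ W (i + (k + 1)) := hW.slow _

/-- No single weight makes up more than the fraction `η` of what follows. -/
theorem le_mul_tail (hW : SlowlyDecreasing η W) (h0 : 0 < η) (h1 : η ≤ 1) {I i : ℕ} (hi : I ≤ i) :
    W i ≤ η * ∑' j, if I ≤ j then W j else 0 := by
  have hgeom := (hasSum_geometric_of_lt_one (r := 1 - η) (by linarith) (by linarith)).mul_right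
    (W i)
  have hinj : Function.Injective fun k : ℕ => i + k := add_right_injective i
  have hsum := hW.summable_ite (fun j => I ≤ j)
  have h : (1 - (1 - η))⁻¹ * W i ≤ ∑' j, if I ≤ j then W j else 0 := by
    refine (hgeom.tsum_eq.symm.le.trans (Summable.tsum_le_tsum (fun k => ?_) hgeom.summable
      (hsum.comp_injective hinj))).trans (tsum_comp_le_tsum_of_inj hsum (fun j => ?_) hinj)
    · simp only [Function.comp_apply]
      rw [if_pos (by omega)]
      exact hW.pow_mul_le h1 i k
    · split_ifs
      exacts [hW.nonneg j, le_rfl]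
  rw [sub_sub_cancel] at h
  calc W i = η * (η⁻¹ * W i) := by field_simp
    _ ≤ _ := mul_le_mul_of_nonneg_left h h0.le

/-- A set of times with gaps of length at least `M` makes up little more than the fraction
`1 / M`. -/
theorem sparse_le_tail (hW : SlowlyDecreasing η W) (h0 : 0 < η) (h1 : η ≤ 1) {M : ℕ}
    {A : Set ℕ} [DecidablePred (· ∈ A)]
    (hA : ∀ i ∈ A, ∀ i' ∈ A, i < i' → i + M ≤ i') (I : ℕ) :
    M * (1 - η) ^ M * (∑' i, if I ≤ i ∧ i ∈ A then W i else 0)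
      ≤ ∑' i, if I ≤ i then W i else 0 := by
  have h10 : 0 ≤ 1 - η := by linarith
  have hsum := hW.summable_ite (fun j => I ≤ j)
  let B := ↥{i : ℕ | I ≤ i ∧ i ∈ A}
  have hinj : Function.Injective fun q : B × Fin M => (q.1 : ℕ) + q.2 := by
    rintro ⟨⟨i, hi⟩, k⟩ ⟨⟨i', hi'⟩, k'⟩ h
    simp only at h
    have hik := k.2
    have hik' := k'.2
    rcases lt_trichotomy i i' with hlt | rfl | hlt
    · have := hA i hi.2 i' hi'.2 hlt; omega
    · have : k = k' := Fin.ext (by omega)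
      subst this; rfl
    · have := hA i' hi'.2 i hi.2 hlt; omega
  have hleft : (∑' i, if I ≤ i ∧ i ∈ A then W i else 0) = ∑' i : B, W i := by
    refine Eq.trans ?_ (tsum_subtype {i : ℕ | I ≤ i ∧ i ∈ A} W).symm
    refine tsum_congr fun i => ?_
    by_cases h : I ≤ i ∧ i ∈ A <;> simp [h]
  have hBs : Summable fun i : B => W i := hW.summable.subtype {i : ℕ | I ≤ i ∧ i ∈ A}
  have hq := hsum.comp_injective hinj
  calc M * (1 - η) ^ M * (∑' i, if I ≤ i ∧ i ∈ A then W i else 0)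
      = ∑' i : B, ∑ _k : Fin M, (1 - η) ^ M * W i := by
        rw [hleft, ← tsum_mul_left]
        refine tsum_congr fun i => ?_
        simp [mul_assoc]
    _ ≤ ∑' i : B, ∑ k : Fin M, (if I ≤ (i : ℕ) + k then W (i + k) else 0) := by
        refine Summable.tsum_le_tsum (fun i => Finset.sum_le_sum fun k _ => ?_) ?_ ?_
        · rw [if_pos (by have := i.2.1; omega)]
          refine le_trans ?_ (hW.pow_mul_le h1 i k)
          refine mul_le_mul_of_nonneg_right ?_ (hW.nonneg _)
          exact pow_le_pow_of_le_one h10 (by linarith) k.2.le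
        · refine Summable.congr (hBs.mul_left (M * (1 - η) ^ M)) fun i => ?_
          simp [mul_assoc]
        · refine Summable.congr hq.prod fun i => ?_
          rw [tsum_fintype]
          rfl
    _ = ∑' q : B × Fin M, (if I ≤ (q.1 : ℕ) + q.2 then W (q.1 + q.2) else 0) := by
        refine Eq.trans ?_ (Summable.tsum_prod hq).symm
        refine tsum_congr fun i => ?_
        rw [tsum_fintype]
        rfl
    _ ≤ _ := by
        refine tsum_comp_le_tsum_of_inj hsum (fun j => ?_) hinj
        split_ifs
        exacts [hW.nonneg j, le_rfl]

end SlowlyDecreasing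

open Classical in
/-- The balance of a deviation that does harm from time `I` on: it gains `G` in a short window and
on a sparse set of times, and loses `1` at all other times from `I` on. -/
def balance (G : ℝ) (B I : ℕ) (A : Set ℕ) (i : ℕ) : ℝ :=
  if i < I then 0 else if i < I + B then G else if i ∈ A then G else -1

namespace SlowlyDecreasing

variable {η : ℝ} {W : ℕ → ℝ}

/-- The expected balance is negative. -/
theorem tsum_balance_le (hW : SlowlyDecreasing η W) (h0 : 0 < η) (h1 : η ≤ 1) {M : ℕ} {A : Set ℕ}
    (hA : ∀ i ∈ A, ∀ i' ∈ A, i < i' → i + M ≤ i') (B I : ℕ) {G κ δ : ℝ} (hG : 0 ≤ G)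
    (hκ : 1 ≤ κ * (M * (1 - η) ^ M)) (hδ : (G + 1) * (B * η + κ) ≤ 1 - δ) :
    ∑' i, W i * balance G B I A i ≤ -δ * ∑' i, if I ≤ i then W i else 0 := by
  classical
  set τ := ∑' i, if I ≤ i then W i else 0 with hτ
  have hτ0 : 0 ≤ τ := tsum_nonneg fun i => by
    split_ifs
    exacts [hW.nonneg i, le_rfl]
  have hs1 := hW.summable_ite (fun j => I ≤ j)
  have hs2 := hW.summable_ite (fun j => I ≤ j ∧ j < I + B)
  have hs3 := hW.summable_ite (fun j => I ≤ j ∧ j ∈ A)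
  have hwin : (∑' i, if I ≤ i ∧ i < I + B then W i else 0) ≤ B * η * τ := by
    rw [tsum_eq_sum (s := Finset.Ico I (I + B))]
    · calc _ ≤ ∑ _i ∈ Finset.Ico I (I + B), η * τ := by
            refine Finset.sum_le_sum fun i hi => ?_
            rw [Finset.mem_Ico] at hi
            rw [if_pos hi]
            exact hW.le_mul_tail h0 h1 hi.1
        _ = B * η * τ := by simp [mul_assoc]
    · intro i hi
      rw [Finset.mem_Ico] at hi
      rw [if_neg hi]
  have hsparse : (∑' i, if I ≤ i ∧ i ∈ A then W i else 0) ≤ κ * τ := by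
    set y := ∑' i, if I ≤ i ∧ i ∈ A then W i else 0
    have hy0 : 0 ≤ y := tsum_nonneg fun i => by
      split_ifs
      exacts [hW.nonneg i, le_rfl]
    have h10 : 0 ≤ (M : ℝ) * (1 - η) ^ M := mul_nonneg (by positivity) (pow_nonneg (by linarith) _)
    have hκ0 : 0 ≤ κ := by
      by_contra hneg
      push Not at hneg
      nlinarith
    calc y ≤ κ * (M * (1 - η) ^ M) * y := by nlinarith
      _ = κ * (M * (1 - η) ^ M * y) := by ring
      _ ≤ κ * τ := mul_le_mul_of_nonneg_left (hW.sparse_le_tail h0 h1 hA I) hκ0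
  have hb : ∀ i, W i * balance G B I A i ≤ -(if I ≤ i then W i else 0) +
      (G + 1) * ((if I ≤ i ∧ i < I + B then W i else 0) + if I ≤ i ∧ i ∈ A then W i else 0) := by
    intro i
    have hWi := hW.nonneg i
    unfold balance
    split_ifs <;> first | omega | (exfalso; tauto) | nlinarith [mul_nonneg hG hWi]
  have hsr : Summable fun i => -(if I ≤ i then W i else 0) + (G + 1) *
      ((if I ≤ i ∧ i < I + B then W i else 0) + if I ≤ i ∧ i ∈ A then W i else 0) :=
    hs1.neg.add ((hs2.add hs3).mul_left _)
  have hsl : Summable fun i => W i * balance G B I A i := by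
    refine Summable.of_norm_bounded (hW.summable.mul_right (G + 1)) fun i => ?_
    rw [norm_mul, Real.norm_of_nonneg (hW.nonneg i)]
    refine mul_le_mul_of_nonneg_left ?_ (hW.nonneg i)
    rw [Real.norm_eq_abs, abs_le]
    unfold balance
    split_ifs <;> constructor <;> linarith
  calc _ ≤ ∑' i, (-(if I ≤ i then W i else 0) + (G + 1) *
      ((if I ≤ i ∧ i < I + B then W i else 0) + if I ≤ i ∧ i ∈ A then W i else 0)) :=
        Summable.tsum_le_tsum hb hsl hsr
    _ = -τ + (G + 1) * ((∑' i, if I ≤ i ∧ i < I + B then W i else 0)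
          + ∑' i, if I ≤ i ∧ i ∈ A then W i else 0) := by
        rw [Summable.tsum_add hs1.neg ((hs2.add hs3).mul_left _), tsum_neg, tsum_mul_left,
          Summable.tsum_add hs2 hs3]
    _ ≤ -τ + (G + 1) * (B * η * τ + κ * τ) := by gcongr
    _ = -τ + (G + 1) * (B * η + κ) * τ := by ring
    _ ≤ -τ + (1 - δ) * τ := by gcongr
    _ = -δ * τ := by ring

end SlowlyDecreasing

/-- Constants for which deviations do not pay. A guess that does not depend on the split number is
right for the fraction `κ` of the split numbers at most, which is close to `1 / M`, where `M` is the
least integer above `U`. -/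
theorem exists_constants {U : ℝ} (hU : 1 ≤ U) :
    ∃ (M N : ℕ) (c δ κ : ℝ), 0 < c ∧ c ≤ 1 ∧ 0 < δ ∧ 0 < N ∧
      (∀ m : ℕ, U < m → M ≤ m) ∧ (U - 1) ≤ (N - 1) * δ ∧
      ∀ D : ℕ, 1 ≤ D → 1 ≤ κ * (M * (1 - c / D) ^ M) ∧
        (U - 1 + 1) * ((2 * D : ℕ) * (c / D) + κ) ≤ 1 - δ := by
  set M := ⌊U⌋₊ + 1 with hM
  have hMU : U < M := by rw [hM]; push_cast; exact Nat.lt_floor_add_one U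
  have hM0 : (0 : ℝ) < M := by linarith
  have hM1 : (1 : ℝ) ≤ M := by linarith
  -- `θ` is what is left of the loss if nothing but the gain `U / M` of a guess is subtracted; half
  -- of it is used up by the window and by the unevenness of the weights
  set θ := 1 - U / M with hθ
  have hθ0 : 0 < θ := by rw [hθ, sub_pos, div_lt_one hM0]; exact hMU
  have hθ1 : θ ≤ 1 := by rw [hθ]; have : 0 ≤ U / M := by positivity
                         linarith
  set c := θ / (8 * U * M) with hc
  have hc0 : 0 < c := by positivity
  have hcU : c * (8 * U * M) = θ := by rw [hc]; field_simp
  have hUM : 1 ≤ U * M := by nlinarith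
  have hcM : c * M ≤ θ / 8 := by nlinarith [mul_pos hc0 hM0]
  have hcU' : U * c ≤ θ / 8 := by nlinarith [mul_pos hc0 (show 0 < U by linarith)]
  have hc1 : c ≤ 1 := by nlinarith
  have hδ0 : 0 < θ / 4 := by positivity
  refine ⟨M, ⌈(U - 1) / (θ / 4)⌉₊ + 1, c, θ / 4, (1 + θ / 4) / M, hc0, hc1, hδ0,
    Nat.succ_pos _, fun m hm => ?_, ?_, fun D hD => ?_⟩
  · rw [hM]
    exact (Nat.floor_lt (by linarith)).2 hm
  · push_cast
    have := Nat.le_ceil ((U - 1) / (θ / 4))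
    rw [div_le_iff₀ hδ0] at this
    linarith
  · have hD1 : (1 : ℝ) ≤ D := by exact_mod_cast hD
    have hD0 : (0 : ℝ) < D := by linarith
    have hcD : c / D ≤ c := div_le_self hc0.le hD1
    have hcD0 : 0 ≤ c / D := by positivity
    constructor
    · have hb : 1 - θ / 8 ≤ (1 - c / D) ^ M := by
        have := one_add_mul_le_pow (a := -(c / D)) (by linarith) M
        have h2 : (M : ℝ) * (c / D) ≤ c * M := by nlinarith
        calc 1 - θ / 8 ≤ 1 + (M : ℝ) * -(c / D) := by linarith
          _ ≤ (1 + -(c / D)) ^ M := this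
          _ = _ := by rw [← sub_eq_add_neg]
      have : (1 + θ / 4) / M * (M * (1 - c / D) ^ M) = (1 + θ / 4) * (1 - c / D) ^ M := by
        field_simp
      rw [this]
      nlinarith
    · push_cast
      have h1 : 2 * (D : ℝ) * (c / D) = 2 * c := by field_simp
      have h2 : U * ((1 + θ / 4) / M) = (1 - θ) * (1 + θ / 4) := by
        rw [hθ]; field_simp; ring
      rw [h1]
      calc (U - 1 + 1) * (2 * c + (1 + θ / 4) / M) = 2 * (U * c) + U * ((1 + θ / 4) / M) := by ring
        _ ≤ 1 - θ / 4 := by rw [h2]; nlinarith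

/-! ### Two binary trees with disjoint sets of inner nodes, and a ring -/

section Trees

variable {n : ℕ}

/-- The position of player `p` in the tree `b`: the players are numbered forwards in one tree and
backwards in the other one. -/
def turn (b : Bool) (p : Fin n) : Fin n := if b then p.rev else p

/-- The number of player `p` in the tree `b`; the root has number `0`. -/
def idx (b : Bool) (p : Fin n) : ℕ := (turn b p).val

/-- The parent of a node in the binary heap on `Fin n`. -/
def heapParent (p : Fin n) : Fin n := ⟨(p.val - 1) / 2, by omega⟩

/-- The parent of player `p` in the tree `b` (the root is its own parent). -/
def par (b : Bool) (p : Fin n) : Fin n := turn b (heapParent (turn b p))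

/-- The depth of player `p` in the tree `b`. -/
def dep (b : Bool) (p : Fin n) : ℕ := Nat.log 2 (idx b p + 1)

/-- The children of player `p` in the tree `b`. -/
def kids (b : Bool) (p : Fin n) : Finset (Fin n) :=
  Finset.univ.filter fun k => idx b k ≠ 0 ∧ par b k = p

/-- Player `p` has no children in the tree `b`. -/
def IsLeaf (b : Bool) (p : Fin n) : Prop := n ≤ 2 * idx b p + 1

/-- A bound for the depth of the trees. -/
def height (n : ℕ) : ℕ := Nat.log 2 n

theorem turn_turn (b : Bool) (p : Fin n) : turn b (turn b p) = p := by
  cases b <;> simp [turn]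

theorem idx_lt (b : Bool) (p : Fin n) : idx b p < n := (turn b p).isLt

theorem idx_injective (b : Bool) : Function.Injective (idx b : Fin n → ℕ) := by
  intro p q h
  have : turn b p = turn b q := Fin.ext h
  rw [← turn_turn b p, this, turn_turn]

theorem idx_par (b : Bool) (p : Fin n) : idx b (par b p) = (idx b p - 1) / 2 := by
  unfold idx par
  rw [turn_turn]
  rfl

theorem par_ne {b : Bool} {p : Fin n} (h : idx b p ≠ 0) : par b p ≠ p := by
  intro heq
  have := idx_par b p
  rw [heq] at this
  omega

theorem dep_eq_dep_par {b : Bool} {p : Fin n} (h : idx b p ≠ 0) :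
    dep b p = dep b (par b p) + 1 := by
  unfold dep
  rw [idx_par, Nat.log_of_one_lt_of_le (by norm_num) (by omega)]
  congr 2
  omega

theorem dep_le (b : Bool) (p : Fin n) : dep b p ≤ height n :=
  Nat.log_mono_right (idx_lt b p)

theorem dep_of_idx_eq_zero {b : Bool} {p : Fin n} (h : idx b p = 0) : dep b p = 0 := by
  simp [dep, h]

theorem not_isLeaf_par {b : Bool} {p : Fin n} (h : idx b p ≠ 0) : ¬ IsLeaf b (par b p) := by
  unfold IsLeaf
  rw [idx_par]
  have := idx_lt b p
  omega

theorem kids_eq_empty {b : Bool} {p : Fin n} (h : IsLeaf b p) : kids b p = ∅ := by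
  rw [Finset.eq_empty_iff_forall_notMem]
  intro k hk
  simp only [kids, Finset.mem_filter, Finset.mem_univ, true_and] at hk
  exact not_isLeaf_par hk.1 (hk.2 ▸ h)

theorem mem_kids {b : Bool} {p k : Fin n} : k ∈ kids b p ↔ idx b k ≠ 0 ∧ par b k = p := by
  simp [kids]

theorem card_kids_le (b : Bool) (p : Fin n) : (kids b p).card ≤ 2 := by
  have : (kids b p).card ≤ ({2 * idx b p + 1, 2 * idx b p + 2} : Finset ℕ).card := by
    refine Finset.card_le_card_of_injOn (idx b) (fun k hk => ?_) (idx_injective b).injOn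
    obtain ⟨h0, rfl⟩ := mem_kids.1 hk
    have := idx_par b k
    simp only [Finset.coe_insert, Finset.coe_singleton, Set.mem_insert_iff,
      Set.mem_singleton_iff]
    omega
  exact this.trans Finset.card_le_two

theorem exists_root (hn : 0 < n) (b : Bool) : ∃ p : Fin n, idx b p = 0 :=
  ⟨turn b ⟨0, hn⟩, by simp [idx, turn_turn]⟩

theorem isLeaf_or_isLeaf (p : Fin n) : IsLeaf false p ∨ IsLeaf true p := by
  have := p.isLt
  simp only [IsLeaf, idx, turn, if_true, Bool.false_eq_true, if_false, Fin.val_rev]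
  omega

open Classical in
/-- A tree in which player `p` is a leaf. -/
def leafTree (p : Fin n) : Bool := if IsLeaf false p then false else true

theorem isLeaf_leafTree (p : Fin n) : IsLeaf (leafTree p) p := by
  unfold leafTree
  split_ifs with h
  · exact h
  · exact (isLeaf_or_isLeaf p).resolve_left h

theorem IsLeaf.idx_ne_zero (hn : 2 ≤ n) {b : Bool} {p : Fin n} (h : IsLeaf b p) : idx b p ≠ 0 := by
  unfold IsLeaf at h
  omega

/-- The player who can verify the contribution of player `p` to the joint key: the parent of `p`
in the tree in which `p` is a leaf. -/
def guardian (p : Fin n) : Fin n := par (leafTree p) p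

theorem guardian_ne (hn : 2 ≤ n) (p : Fin n) : guardian p ≠ p :=
  par_ne ((isLeaf_leafTree p).idx_ne_zero hn)

theorem sum_kids {G : Type} [AddCommMonoid G] (b : Bool) (f : Fin n → G) :
    ∑ p, ∑ k ∈ kids b p, f k = ∑ k ∈ Finset.univ.filter (fun k => idx b k ≠ 0), f k := by
  rw [← Finset.sum_fiberwise (Finset.univ.filter (fun k : Fin n => idx b k ≠ 0)) (par b) f]
  refine Finset.sum_congr rfl fun p _ => Finset.sum_congr ?_ fun _ _ => rfl
  ext k
  simp [kids]

/-- If every node of a tree adds its own contribution to the sums of its children, the root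
obtains the sum of all contributions. -/
theorem eq_sum_of_tree {G : Type} [AddCommGroup G] {b : Bool} {f r : Fin n → G}
    (h : ∀ p, f p = r p + ∑ k ∈ kids b p, f k) {p : Fin n} (hp : idx b p = 0) :
    f p = ∑ k, r k := by
  have h1 : ∑ k, f k = ∑ k, r k + ∑ k ∈ Finset.univ.filter (fun k => idx b k ≠ 0), f k := by
    rw [← sum_kids, ← Finset.sum_add_distrib]
    exact Finset.sum_congr rfl fun k _ => h k
  have h2 : ∑ k, f k = f p + ∑ k ∈ Finset.univ.filter (fun k => idx b k ≠ 0), f k := by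
    rw [← Finset.sum_filter_add_sum_filter_not Finset.univ (fun k => idx b k = 0)]
    congr 1
    have : Finset.univ.filter (fun k => idx b k = 0) = {p} := by
      ext k
      simp only [Finset.mem_filter, Finset.mem_univ, true_and, Finset.mem_singleton]
      exact ⟨fun hk => idx_injective b (hk.trans hp.symm), fun hk => hk ▸ hp⟩
    rw [this, Finset.sum_singleton]
  rw [h1] at h2
  exact (add_right_cancel h2).symm

/-- Neighbours on the ring of all players. -/
def RingAdj (p q : Fin n) : Prop :=
  q.val = p.val + 1 ∨ p.val = q.val + 1 ∨ (p.val = 0 ∧ q.val + 1 = n) ∨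
    (q.val = 0 ∧ p.val + 1 = n)

/-- The class of a player: a proper colouring of the ring with three colours. -/
def cls (p : Fin n) : Fin 3 :=
  if p.val + 1 = n then 2 else if p.val % 2 = 0 then 0 else 1

theorem cls_ne_cls (hn : 3 ≤ n) {p q : Fin n} (h : RingAdj p q) : cls p ≠ cls q := by
  have hp := p.isLt
  have hq := q.isLt
  unfold RingAdj at h
  unfold cls
  split_ifs <;> first | decide | (exfalso; omega)

/-- This is where three players are needed: every player has two different ring neighbours, so
that at least one of them does not deviate. -/
theorem exists_ringAdj_ne (hn : 3 ≤ n) (p d : Fin n) : ∃ k, k ≠ d ∧ k ≠ p ∧ RingAdj k p := by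
  have hp := p.isLt
  let a : Fin n := if h : p.val + 1 < n then ⟨p.val + 1, h⟩ else ⟨0, by omega⟩
  let c : Fin n := if p.val = 0 then ⟨n - 1, by omega⟩ else ⟨p.val - 1, by omega⟩
  have ha : a.val = if p.val + 1 < n then p.val + 1 else 0 := by
    simp only [a]; split_ifs <;> rfl
  have hc : c.val = if p.val = 0 then n - 1 else p.val - 1 := by
    simp only [c]; split_ifs <;> rfl
  by_cases had : a = d
  · refine ⟨c, ?_, ?_, ?_⟩
    · rw [← had]
      intro h
      rw [Fin.ext_iff, ha, hc] at h
      split_ifs at h <;> omega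
    · intro h
      rw [Fin.ext_iff, hc] at h
      split_ifs at h <;> omega
    · unfold RingAdj
      rw [hc]
      split_ifs <;> omega
  · refine ⟨a, had, ?_, ?_⟩
    · intro h
      rw [Fin.ext_iff, ha] at h
      split_ifs at h <;> omega
    · unfold RingAdj
      rw [ha]
      split_ifs <;> omega

/-- Two players are neighbours if they are neighbours on the ring or in one of the trees. -/
def Adj (p q : Fin n) : Prop :=
  p ≠ q ∧ (RingAdj p q ∨ ∃ b, q ∈ kids b p ∨ p ∈ kids b q)

theorem Adj.symm {p q : Fin n} (h : Adj p q) : Adj q p := by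
  refine ⟨h.1.symm, ?_⟩
  rcases h.2 with h | ⟨b, h⟩
  · left; unfold RingAdj at *; omega
  · exact Or.inr ⟨b, h.symm⟩

theorem adj_par {b : Bool} {p : Fin n} (h : idx b p ≠ 0) : Adj p (par b p) :=
  ⟨(par_ne h).symm, Or.inr ⟨b, Or.inr (mem_kids.2 ⟨h, rfl⟩)⟩⟩

open Classical in
theorem card_adj_le (p : Fin n) : (Finset.univ.filter fun q => Adj p q).card ≤ 10 := by
  have hsub : (Finset.univ.filter fun q => Adj p q) ⊆
      (Finset.univ.filter fun q => RingAdj p q) ∪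
        ((kids false p ∪ {par false p}) ∪ (kids true p ∪ {par true p})) := by
    intro q hq
    simp only [Finset.mem_filter, Finset.mem_univ, true_and] at hq
    simp only [Finset.mem_union, Finset.mem_filter, Finset.mem_univ, true_and,
      Finset.mem_singleton]
    rcases hq.2 with h | ⟨b, h | h⟩
    · exact Or.inl h
    · cases b <;> simp [h]
    · cases b <;> simp [(mem_kids.1 h).2]
  have hring : (Finset.univ.filter fun q => RingAdj p q).card ≤ 4 := by
    have : (Finset.univ.filter fun q => RingAdj p q).card
        ≤ ({p.val + 1, p.val - 1, n - 1, 0} : Finset ℕ).card := by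
      refine Finset.card_le_card_of_injOn Fin.val (fun q hq => ?_) Fin.val_injective.injOn
      have hq : RingAdj p q := (Finset.mem_filter.1 hq).2
      unfold RingAdj at hq
      simp only [Finset.coe_insert, Finset.coe_singleton, Set.mem_insert_iff,
        Set.mem_singleton_iff]
      omega
    exact this.trans Finset.card_le_four
  have hk : ∀ b, (kids b p ∪ {par b p}).card ≤ 3 := fun b =>
    (Finset.card_union_le _ _).trans (by
      have := card_kids_le b p
      simp only [Finset.card_singleton]; omega)
  have h1 := Finset.card_le_card hsub
  have h2 := Finset.card_union_le (Finset.univ.filter fun q => RingAdj p q)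
        ((kids false p ∪ {par false p}) ∪ (kids true p ∪ {par true p}))
  have h3 := Finset.card_union_le (kids false p ∪ {par false p}) (kids true p ∪ {par true p})
  have h4 := hk false
  have h5 := hk true
  omega

/-- Something that spreads between neighbours other than `d` reaches everybody but `d` quickly:
up and down the tree in which `d` is a leaf. -/
theorem spread (hn : 2 ≤ n) {d : Fin n} {T₀ : ℕ} {X : ℕ → Fin n → Prop}
    (hmono : ∀ T ≥ T₀, ∀ p, p ≠ d → X T p → X (T + 1) p)
    (hadj : ∀ T ≥ T₀, ∀ p q, p ≠ d → q ≠ d → Adj p q → X T p → X (T + 1) q)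
    {T : ℕ} (hT : T₀ ≤ T) {p : Fin n} (hp : p ≠ d) (hX : X T p) {q : Fin n} (hq : q ≠ d) :
    X (T + 2 * height n) q := by
  set b := leafTree d
  have hd : IsLeaf b d := isLeaf_leafTree d
  have hmono' : ∀ k T, T₀ ≤ T → ∀ p, p ≠ d → X T p → X (T + k) p := by
    intro k T hT p hp h
    induction k with
    | zero => exact h
    | succ k ih => exact hmono (T + k) (by omega) p hp ih
  have hpar : ∀ p, idx b p ≠ 0 → par b p ≠ d := fun p h0 h => not_isLeaf_par h0 (h ▸ hd)
  obtain ⟨root, hroot⟩ := exists_root (n := n) (by omega) b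
  have hrootd : root ≠ d := fun h => hd.idx_ne_zero hn (h ▸ hroot)
  have hup : ∀ k T, T₀ ≤ T → ∀ p, p ≠ d → dep b p = k → X T p → X (T + k) root := by
    intro k
    induction k with
    | zero =>
      intro T hT p hp hk h
      have : p = root := by
        refine idx_injective b ?_
        rw [hroot]
        by_contra h0
        have := dep_eq_dep_par h0
        omega
      exact this ▸ h
    | succ k ih =>
      intro T hT p hp hk h
      have h0 : idx b p ≠ 0 := by
        intro h0
        rw [dep_of_idx_eq_zero h0] at hk
        omega
      have := ih (T + 1) (by omega) (par b p) (hpar p h0)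
        (by have := dep_eq_dep_par h0; omega)
        (hadj T hT p _ hp (hpar p h0) (adj_par h0) h)
      rwa [show T + (k + 1) = T + 1 + k by ring]
  have hdown : ∀ k T, T₀ ≤ T → X T root → ∀ q, q ≠ d → dep b q = k → X (T + k) q := by
    intro k
    induction k with
    | zero =>
      intro T hT h q hq hk
      have : q = root := by
        refine idx_injective b ?_
        rw [hroot]
        by_contra h0
        have := dep_eq_dep_par h0
        omega
      exact this ▸ h
    | succ k ih =>
      intro T hT h q hq hk
      have h0 : idx b q ≠ 0 := by
        intro h0
        rw [dep_of_idx_eq_zero h0] at hk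
        omega
      have := ih T hT h (par b q) (hpar q h0) (by have := dep_eq_dep_par h0; omega)
      exact hadj (T + k) (by omega) _ q (hpar q h0) hq (adj_par h0).symm this
  have h1 := hup _ T hT p hp rfl hX
  have h2 := hdown _ _ (by omega) h1 q hq rfl
  have h3 := dep_le b p
  have h4 := dep_le b q
  have := hmono' (2 * height n - (dep b p + dep b q)) _ (by omega) q hq h2
  rwa [show T + dep b p + dep b q + (2 * height n - (dep b p + dep b q)) = T + 2 * height n by
    omega] at this

end Trees

/-! ### The protocol -/

section Encoding

variable {m N : ℕ} [NeZero m] [NeZero N]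

/-- Values of the joint key and tags are sent as binary numbers. -/
def enc (v : ZMod m × ZMod N) : Msg := Nat.bits (Fintype.equivFin (ZMod m × ZMod N) v).val

/-- Decoding is total: a message that is not the encoding of anything stands for some value. -/
def dec : Msg → ZMod m × ZMod N := Function.invFun enc

theorem bits_injective : Function.Injective Nat.bits := by
  intro a b h
  refine Nat.eq_of_testBit_eq fun i => ?_
  rw [Nat.testBit_eq_inth, Nat.testBit_eq_inth, h]

@[simp] theorem dec_enc (v : ZMod m × ZMod N) : dec (enc v) = v := by
  refine Function.leftInverse_invFun (fun v w h => ?_) v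
  exact (Fintype.equivFin _).injective (Fin.ext (bits_injective h))

theorem length_enc_le (v : ZMod m × ZMod N) : (enc v).length ≤ Nat.size (m * N) := by
  unfold enc
  rw [Nat.size_eq_bits_len]
  refine Nat.size_le_size ?_
  have h := (Fintype.equivFin (ZMod m × ZMod N) v).isLt
  have hc : Fintype.card (ZMod m × ZMod N) = m * N := by
    rw [Fintype.card_prod, ZMod.card, ZMod.card]
  exact (h.trans_eq hc).le

end Encoding

/-- The code of a symbol; it is not empty, so that silence is not a symbol. -/
def code (a : Fin 3) : Msg := List.replicate (a.val + 1) true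

theorem code_injective : Function.Injective code := by
  intro a b h
  have := congrArg List.length h
  simp only [code, List.length_replicate] at this
  exact Fin.ext (by omega)

theorem code_ne_nil (a : Fin 3) : code a ≠ [] := by simp [code]

theorem length_code_le (a : Fin 3) : (code a).length ≤ 3 := by
  simp only [code, List.length_replicate]
  omega

/-- The share of one player: a contribution to the joint key, the tag that authenticates it, the
keys with which the contributions of other players are verified, and a sequence of symbols. -/
structure PlayerShare (n m N : ℕ) : Type where
  part : ZMod m
  tag : ZMod N
  key : Fin n → ZMod m → ZMod N
  seq : SymSeq

section Player

variable {n m N : ℕ}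

/-- The time step in which player `p` sends the sum of the contributions in his subtree upwards.
The two trees are processed one after the other. -/
def upTime (b : Bool) (p : Fin n) : ℕ := (if b then 2 * height n else 0) + (height n - dep b p)

/-- The time step in which player `p` sends the total sum downwards. -/
def downTime (b : Bool) (p : Fin n) : ℕ := (if b then 2 * height n else 0) + (height n + dep b p)

/-- The time step in which the joint key is known to everybody and the exchange of symbols
begins. -/
def endTime (n : ℕ) : ℕ := 4 * height n

variable [NeZero m] [NeZero N]

/-- The sum of the contributions in the subtree below player `p`. -/
def treeSum (b : Bool) (p : Fin n) (a : PlayerShare n m N) (h : History n) : ZMod m :=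
  a.part + ∑ k ∈ kids b p, (dec (m := m) (N := N) (received h (upTime b k) k)).1

/-- The sum of all contributions, as the tree `b` delivers it to player `p`. -/
def treeResult (b : Bool) (p : Fin n) (a : PlayerShare n m N) (h : History n) : ZMod m :=
  if idx b p = 0 then treeSum b p a h
  else (dec (m := m) (N := N) (received h (downTime b (par b p)) (par b p))).1

open Classical in
/-- The messages of the phase in which the contributions are added in the tree `b`. -/
def treeSend (b : Bool) (p : Fin n) (a : PlayerShare n m N) (h : History n) (q : Fin n) : Msg :=
  if p ∈ kids b q ∧ h.length = upTime b p then enc (treeSum b p a h, a.tag)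
  else if q ∈ kids b p ∧ h.length = downTime b p then enc (treeResult b p a h, (0 : ZMod N))
  else []

/-- Both trees deliver the same joint key, and the contributions player `p` can verify are
authentic. -/
def KeyOk (p : Fin n) (a : PlayerShare n m N) (h : History n) : Prop :=
  treeResult false p a h = treeResult true p a h ∧
    ∀ k, guardian k = p →
      (dec (m := m) (N := N) (received h (upTime (leafTree k) k) k)).2 =
        a.key k (dec (m := m) (N := N) (received h (upTime (leafTree k) k) k)).1

/-- All symbols received from the neighbours so far are equal to the own ones. -/
def SymbolsOk (p : Fin n) (a : PlayerShare n m N) (h : History n) : Prop :=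
  ∀ i, endTime n + i < h.length → ∀ k, Adj k p → received h (endTime n + i) k = code (a.seq i)

/-- Player `p` has no reason to stop. -/
def Ok (p : Fin n) (a : PlayerShare n m N) (h : History n) : Prop :=
  KeyOk p a h ∧ SymbolsOk p a h

open Classical in
/-- The prescribed strategy. The joint key is computed in both trees; then the symbols are
exchanged between neighbours, one per time step, until something is wrong. The player who sees for
the first time that something is wrong with the `i`-th symbols outputs the `i`-th candidate, the
joint key plus `i`, and is silent ever after. (A player who rejects the joint key itself outputs
candidate `0`, by the truncated subtraction.) -/
def player {S : Type} (e : S ≃ ZMod m) (p : Fin n) : Strategy n S (PlayerShare n m N) where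
  send a h q :=
    if h.length < 2 * height n then treeSend false p a h q
    else if h.length < endTime n then treeSend true p a h q
    else if Ok p a h ∧ Adj p q then code (a.seq (h.length - endTime n))
    else []
  output a h :=
    if h.length < endTime n ∨ Ok p a h then none
    else some (e.symm (treeResult false p a h + ((h.length - endTime n - 1 : ℕ) : ZMod m)))

/-- The protocol with a given dealer. -/
@[reducible] def protocol {S : Type} (e : S ≃ ZMod m)
    (deal : S → PMF (Fin n → PlayerShare n m N)) : Protocol n S where
  Share := PlayerShare n m N
  deal := deal
  player := player e

theorem upTime_lt_endTime {b : Bool} {p : Fin n} (h : idx b p ≠ 0) : upTime b p < endTime n := by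
  have h1 := dep_eq_dep_par h
  have h2 := dep_le b p
  unfold upTime endTime
  split_ifs <;> omega

theorem downTime_lt_endTime {b : Bool} {p : Fin n} (h : idx b p ≠ 0) :
    downTime b (par b p) < endTime n := by
  have h1 := dep_eq_dep_par h
  have h2 := dep_le b p
  unfold downTime endTime
  split_ifs <;> omega

theorem upTime_kid_lt {b : Bool} {p k : Fin n} (hk : k ∈ kids b p) :
    upTime b k < upTime b p := by
  obtain ⟨h0, rfl⟩ := mem_kids.1 hk
  have h1 := dep_eq_dep_par h0
  have h2 := dep_le b k
  unfold upTime
  omega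

section Send

variable {S : Type} {e : S ≃ ZMod m} {p q : Fin n} {a a' : PlayerShare n m N} {h : History n}

theorem send_of_lt_endTime {b : Bool} (hb : if b then 2 * height n ≤ h.length ∧
    h.length < endTime n else h.length < 2 * height n) :
    (player e p).send a h q = treeSend b p a h q := by
  cases b
  · simp only [Bool.false_eq_true, if_false] at hb
    simp [player, hb]
  · simp only [if_true] at hb
    have : ¬ h.length < 2 * height n := by omega
    simp [player, hb.2, this]

theorem send_up {b : Bool} (hp : idx b p ≠ 0) (hh : h.length = upTime b p) :
    (player e p).send a h (par b p) = enc (treeSum b p a h, a.tag) := by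
  have h1 := dep_eq_dep_par hp
  have h2 := dep_le b p
  rw [send_of_lt_endTime (b := b), treeSend, if_pos ⟨mem_kids.2 ⟨hp, rfl⟩, hh⟩]
  rw [hh]
  unfold upTime endTime
  cases b <;> simp <;> omega

theorem send_down {b : Bool} (hq : q ∈ kids b p) (hh : h.length = downTime b p) :
    (player e p).send a h q = enc (treeResult b p a h, (0 : ZMod N)) := by
  obtain ⟨h0, rfl⟩ := mem_kids.1 hq
  have h1 := dep_eq_dep_par h0
  have h2 := dep_le b q
  rw [send_of_lt_endTime (b := b), treeSend, if_neg, if_pos ⟨hq, hh⟩]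
  · rintro ⟨hk, hh'⟩
    have h3 := dep_eq_dep_par (mem_kids.1 hk).1
    rw [hh] at hh'
    unfold upTime downTime at hh'
    omega
  · rw [hh]
    unfold downTime endTime
    cases b <;> simp <;> omega

theorem send_symbol (hh : endTime n ≤ h.length) (hok : Ok p a h) (hadj : Adj p q) :
    (player e p).send a h q = code (a.seq (h.length - endTime n)) := by
  have h1 : ¬ h.length < 2 * height n := by unfold endTime at hh; omega
  have h2 : ¬ h.length < endTime n := by omega
  simp [player, h1, h2, hok, hadj]

theorem send_of_not_ok (hh : endTime n ≤ h.length) (hok : ¬ Ok p a h) :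
    (player e p).send a h q = [] := by
  have h1 : ¬ h.length < 2 * height n := by unfold endTime at hh; omega
  have h2 : ¬ h.length < endTime n := by omega
  simp [player, h1, h2, hok]

theorem treeSum_congr {b : Bool} (hpart : a.part = a'.part) :
    treeSum b p a h = treeSum b p a' h := by
  simp [treeSum, hpart]

theorem treeResult_congr {b : Bool} (hpart : a.part = a'.part) :
    treeResult b p a h = treeResult b p a' h := by
  simp [treeResult, treeSum_congr hpart]

theorem ok_congr (hpart : a.part = a'.part) (hkey : a.key = a'.key)
    (hseq : ∀ i, endTime n + i < h.length → a.seq i = a'.seq i) : Ok p a h ↔ Ok p a' h := by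
  unfold Ok KeyOk SymbolsOk
  rw [treeResult_congr hpart, treeResult_congr hpart, hkey]
  refine and_congr_right fun _ => forall_congr' fun i => forall_congr' fun hi => ?_
  rw [hseq i hi]

/-- In the first phase the keys and the symbols are not used, and in the second phase future
symbols are not used. -/
theorem send_congr (hpart : a.part = a'.part) (htag : a.tag = a'.tag)
    (hkey : endTime n ≤ h.length → a.key = a'.key)
    (hseq : ∀ i, endTime n + i ≤ h.length → a.seq i = a'.seq i) :
    (player e p).send a h q = (player e p).send a' h q := by
  have h1 : ∀ b, treeSend b p a h q = treeSend b p a' h q := by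
    intro b
    simp only [treeSend, treeSum_congr hpart, treeResult_congr hpart, htag]
  by_cases hh : endTime n ≤ h.length
  · have h2 := ok_congr (p := p) (h := h) hpart (hkey hh) (fun i hi => hseq i hi.le)
    by_cases hok : Ok p a h
    · by_cases hadj : Adj p q
      · rw [send_symbol hh hok hadj, send_symbol hh (h2.1 hok) hadj,
          hseq (h.length - endTime n) (by omega)]
      · have h3 : ¬ h.length < 2 * height n := by unfold endTime at hh; omega
        have h4 : ¬ h.length < endTime n := by omega
        simp [player, hadj, h3, h4]
    · rw [send_of_not_ok hh hok, send_of_not_ok hh (fun h' => hok (h2.2 h'))]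
  · have h2 : h.length < endTime n := by omega
    simp only [player, h1, h2, if_true]

end Send

/-! ### Runs of the protocol with one deviator -/

section Run

variable {S : Type} {e : S ≃ ZMod m} {deal : S → PMF (Fin n → PlayerShare n m N)}
  {d : Fin n} {σ : Strategy n S (PlayerShare n m N)} {x x' : Fin n → PlayerShare n m N}

local notation "H" => Protocol.devHist (protocol e deal) d σ
local notation "Z" => Protocol.devSent (protocol e deal) d σ

theorem sent_eq {k : Fin n} (hk : k ≠ d) (t : ℕ) (l : Fin n) :
    Z x t k l = (player e k).send (x k) (H x t k) l :=
  Protocol.devSent_of_ne (P := protocol e deal) hk t l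

theorem length_run (t : ℕ) (p : Fin n) : (H x t p).length = t :=
  Protocol.length_devHist (P := protocol e deal) t p

theorem received_run {t T : ℕ} (h : t < T) {p k : Fin n} (hk : k ≠ p) :
    received (H x T p) t k = Z x t k p :=
  Protocol.received_devHist (P := protocol e deal) h hk

theorem received_run_mono {t T T' : ℕ} (h : t < T) (hT : T ≤ T') (p k : Fin n) :
    received (H x T' p) t k = received (H x T p) t k := by
  induction T', hT using Nat.le_induction with
  | base => rfl
  | succ T' hT ih =>
    have h1 := Protocol.devHist_succ (P := protocol e deal) (j := d) (σ := σ) (x := x) T' p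
    rw [h1, received_append_left _ _ (by rw [length_run]; omega), ih]

theorem ok_mono {T T' : ℕ} (hT : endTime n ≤ T) (hT' : T ≤ T') {p : Fin n} (hn : 2 ≤ n)
    (h : Ok p (x p) (H x T' p)) : Ok p (x p) (H x T p) := by
  have hr : ∀ t < T, ∀ k, received (H x T' p) t k = received (H x T p) t k :=
    fun t ht k => received_run_mono ht hT' p k
  have hsum : ∀ b, treeSum b p (x p) (H x T' p) = treeSum b p (x p) (H x T p) := by
    intro b
    unfold treeSum
    congr 1
    refine Finset.sum_congr rfl fun k hk => ?_
    rw [hr _ ((upTime_lt_endTime (mem_kids.1 hk).1).trans_le hT)]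
  have hres : ∀ b, treeResult b p (x p) (H x T' p) = treeResult b p (x p) (H x T p) := by
    intro b
    unfold treeResult
    split_ifs with h0
    · exact hsum b
    · rw [hr _ ((downTime_lt_endTime h0).trans_le hT)]
  obtain ⟨⟨h1, h2⟩, h3⟩ := h
  refine ⟨⟨by rw [← hres, ← hres, h1], fun k hk => ?_⟩, fun i hi k hk => ?_⟩
  · have := h2 k hk
    rwa [hr _ ((upTime_lt_endTime ((isLeaf_leafTree k).idx_ne_zero hn)).trans_le hT)] at this
  · rw [length_run] at hi
    rw [← hr _ hi]
    exact h3 i (by rw [length_run]; omega) k hk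

/-- The sums do not change any more once they have been sent. -/
theorem treeSum_run {b : Bool} {p : Fin n} {T : ℕ} (hT : upTime b p ≤ T) :
    treeSum b p (x p) (H x T p) =
      (x p).part + ∑ k ∈ kids b p, (dec (m := m) (N := N) (Z x (upTime b k) k p)).1 := by
  unfold treeSum
  congr 1
  refine Finset.sum_congr rfl fun k hk => ?_
  have hkp : k ≠ p := fun h => by
    obtain ⟨h0, h1⟩ := mem_kids.1 hk
    exact par_ne h0 (h1.trans h.symm)
  rw [received_run ((upTime_kid_lt hk).trans_le hT) hkp]

/-- The contribution and the tag that the deviator sends upwards in the tree `b`. -/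
def claimed (e : S ≃ ZMod m) (deal : S → PMF (Fin n → PlayerShare n m N)) (d : Fin n)
    (σ : Strategy n S (PlayerShare n m N)) (x : Fin n → PlayerShare n m N) (b : Bool) :
    ZMod m × ZMod N :=
  dec (Protocol.devSent (protocol e deal) d σ x (upTime b d) d (par b d))

/-- The joint key that results from the contribution the deviator claims in the tree `b`. -/
def claimedKey (e : S ≃ ZMod m) (deal : S → PMF (Fin n → PlayerShare n m N)) (d : Fin n)
    (σ : Strategy n S (PlayerShare n m N)) (x : Fin n → PlayerShare n m N) (b : Bool) : ZMod m :=
  ∑ k, if k = d then (claimed e deal d σ x b).1 else (x k).part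

/-- In the tree in which the deviator is a leaf, his only influence on the result is the
contribution he claims. -/
theorem treeResult_run (hn : 2 ≤ n) {b : Bool} (hd : IsLeaf b d) {q : Fin n} (hq : q ≠ d) {T : ℕ}
    (hT : downTime b q ≤ T) :
    treeResult b q (x q) (H x T q) = claimedKey e deal d σ x b := by
  have hd0 := hd.idx_ne_zero hn
  have hroot : ∀ p, idx b p = 0 → ∀ T, upTime b p ≤ T →
      treeSum b p (x p) (H x T p) = claimedKey e deal d σ x b := by
    intro p hp T hT
    let f : Fin n → ZMod m := fun k =>
      if idx b k = 0 then treeSum b k (x k) (H x T k)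
      else (dec (m := m) (N := N) (Z x (upTime b k) k (par b k))).1
    have hf : f p = claimedKey e deal d σ x b := by
      refine eq_sum_of_tree (b := b) (f := f) (fun k => ?_) hp
      have hkids : ∑ c ∈ kids b k, f c
          = ∑ c ∈ kids b k, (dec (m := m) (N := N) (Z x (upTime b c) c k)).1 := by
        refine Finset.sum_congr rfl fun c hc => ?_
        obtain ⟨h0, rfl⟩ := mem_kids.1 hc
        simp only [f, h0, if_false]
      rw [hkids]
      by_cases hk : k = d
      · subst hk
        simp only [f, hd0, if_false, if_true, kids_eq_empty hd, Finset.sum_empty, add_zero]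
        rfl
      · simp only [hk, if_false]
        by_cases h0 : idx b k = 0
        · have hkp : k = p := idx_injective b (h0.trans hp.symm)
          subst hkp
          simp only [f, h0, if_true]
          exact treeSum_run hT
        · simp only [f, h0, if_false]
          rw [sent_eq hk, send_up h0 (length_run _ _), dec_enc]
          exact treeSum_run le_rfl
    rw [← hf]
    simp [f, hp]
  have key : ∀ k T q, q ≠ d → dep b q = k → downTime b q ≤ T →
      treeResult b q (x q) (H x T q) = claimedKey e deal d σ x b := by
    intro k
    induction k with
    | zero =>
      intro T q hq hk hT
      have h0 : idx b q = 0 := by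
        by_contra h0
        have := dep_eq_dep_par h0
        omega
      rw [treeResult, if_pos h0]
      refine hroot q h0 T ?_
      unfold upTime
      unfold downTime at hT
      omega
    | succ k ih =>
      intro T q hq hk hT
      have h0 : idx b q ≠ 0 := by
        intro h0
        rw [dep_of_idx_eq_zero h0] at hk
        omega
      have hdep := dep_eq_dep_par h0
      have hpd : par b q ≠ d := fun h => not_isLeaf_par h0 (h ▸ hd)
      have hlt : downTime b (par b q) < T := by
        unfold downTime at hT ⊢
        omega
      rw [treeResult, if_neg h0, received_run hlt (par_ne h0), sent_eq hpd,
        send_down (mem_kids.2 ⟨h0, rfl⟩) (length_run _ _), dec_enc]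
      exact ih _ _ hpd (by omega) le_rfl
  exact key _ T q hq rfl hT

theorem downTime_le_endTime (b : Bool) (q : Fin n) : downTime b q ≤ endTime n := by
  have := dep_le b q
  unfold downTime endTime
  split_ifs <;> omega

/-- A player who is content with the joint key has the one to which the deviator contributed in
the tree in which he is a leaf. -/
theorem treeResult_of_keyOk (hn : 2 ≤ n) {q : Fin n} (hq : q ≠ d) {T : ℕ} (hT : endTime n ≤ T)
    (hok : KeyOk q (x q) (H x T q)) :
    treeResult false q (x q) (H x T q) = claimedKey e deal d σ x (leafTree d) := by
  have h := treeResult_run (e := e) (deal := deal) (σ := σ) (x := x) hn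
    (isLeaf_leafTree d) hq
    ((downTime_le_endTime _ q).trans hT)
  cases hb : leafTree d
  · rw [hb] at h; exact h
  · rw [hb] at h; rw [hok.1]; exact h

theorem tag_of_keyOk (hn : 2 ≤ n) {T : ℕ} (hT : endTime n ≤ T)
    (hok : KeyOk (guardian d) (x (guardian d)) (H x T (guardian d))) :
    (claimed e deal d σ x (leafTree d)).2 =
      (x (guardian d)).key d (claimed e deal d σ x (leafTree d)).1 := by
  have h := hok.2 d rfl
  rwa [received_run ((upTime_lt_endTime ((isLeaf_leafTree d).idx_ne_zero hn)).trans_le hT)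
    (guardian_ne hn d).symm] at h

theorem claimedKey_eq_sum {b : Bool} (h : (claimed e deal d σ x b).1 = (x d).part) :
    claimedKey e deal d σ x b = ∑ k, (x k).part := by
  unfold claimedKey
  refine Finset.sum_congr rfl fun k _ => ?_
  split_ifs with hk
  · rw [h, hk]
  · rfl

/-- A player who has stopped makes his neighbours stop. -/
theorem not_ok_of_adj {T : ℕ} (hT : endTime n ≤ T) {p q : Fin n} (hp : p ≠ d)
    (hadj : Adj p q) (hok : ¬ Ok p (x p) (H x T p)) : ¬ Ok q (x q) (H x (T + 1) q) := by
  intro h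
  have h1 := h.2 (T - endTime n) (by rw [length_run]; omega) p hadj
  rw [Nat.add_sub_cancel' hT, received_run (Nat.lt_succ_self T) hadj.1, sent_eq hp,
    send_of_not_ok (by rw [length_run]; exact hT) hok] at h1
  exact code_ne_nil _ h1.symm

/-- Once one of the other players has stopped, all of them stop soon. -/
theorem not_ok_spread (hn : 2 ≤ n) {T : ℕ} (hT : endTime n ≤ T) {p q : Fin n} (hp : p ≠ d)
    (hq : q ≠ d) (hok : ¬ Ok p (x p) (H x T p)) :
    ¬ Ok q (x q) (H x (T + 2 * height n) q) :=
  spread (X := fun T p => ¬ Ok p (x p) (H x T p)) hn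
    (fun _ hT _ _ h h' => h (ok_mono hT (Nat.le_succ _) hn h'))
    (fun _ hT _ _ hp _ hadj h => not_ok_of_adj hT hp hadj h) hT hp hok hq

/-- When the symbols of the three classes differ, everybody stops, whatever the deviator does:
everybody has an honest neighbour on the ring. -/
theorem not_ok_of_split (hn : 3 ≤ n) {i : ℕ}
    (hok : ∀ p, p ≠ d → Ok p (x p) (H x (endTime n + i) p))
    (hsplit : ∀ p q, cls p ≠ cls q → (x p).seq i ≠ (x q).seq i) {p : Fin n} :
    ¬ Ok p (x p) (H x (endTime n + i + 1) p) := by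
  obtain ⟨k, hkd, hkp, hring⟩ := exists_ringAdj_ne hn p d
  intro h
  have hadj : Adj k p := ⟨hkp, Or.inl hring⟩
  have h1 := h.2 i (by rw [length_run]; omega) k hadj
  rw [received_run (Nat.lt_succ_self _) hkp, sent_eq hkd,
    send_symbol (by rw [length_run]; omega) (hok k hkd) hadj, length_run,
    Nat.add_sub_cancel_left] at h1
  exact hsplit k p (cls_ne_cls hn hring) (code_injective h1)

/-- The output of a player who stops after the `i`-th symbols. -/
theorem firstOutput_of_halt (hn : 2 ≤ n) {i : ℕ} {p : Fin n}
    (hok : Ok p (x p) (H x (endTime n + i) p))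
    (hhalt : ¬ Ok p (x p) (H x (endTime n + i + 1) p)) :
    firstOutput (fun t => (player e p).output (x p) (H x t p)) =
      some (e.symm (treeResult false p (x p) (H x (endTime n + i + 1) p) + (i : ZMod m))) := by
  refine firstOutput_eq (T := endTime n + i + 1) (fun t ht => ?_) ?_
  · by_cases h : t < endTime n
    · simp [player, h]
    · have := ok_mono (T := t) (T' := endTime n + i) (x := x) (by omega) (by omega) hn hok
      simp [player, this]
  · have h1 : ¬ (endTime n + i + 1 < endTime n) := by omega
    have h2 : endTime n + i + 1 - endTime n - 1 = i := by omega
    simp only [player, hhalt, h1, h2, or_self, if_false, length_run]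

/-- If nobody has stopped before the symbols of the classes differ for the first time, everybody
but the deviator outputs the right candidate. -/
theorem firstOutput_of_split (hn : 3 ≤ n) {i : ℕ}
    (hok : ∀ p, p ≠ d → Ok p (x p) (H x (endTime n + i) p))
    (hsplit : ∀ p q, cls p ≠ cls q → (x p).seq i ≠ (x q).seq i)
    (hclaim : (claimed e deal d σ x (leafTree d)).1 = (x d).part) {p : Fin n} (hp : p ≠ d) :
    firstOutput (fun t => (player e p).output (x p) (H x t p)) =
      some (e.symm (∑ k, (x k).part + (i : ZMod m))) := by
  rw [firstOutput_of_halt (by omega) (hok p hp) (not_ok_of_split hn hok hsplit)]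
  have hres : treeResult false p (x p) (H x (endTime n + i + 1) p)
      = treeResult false p (x p) (H x (endTime n + i) p) := by
    have hr : ∀ t < endTime n, ∀ k, received (H x (endTime n + i + 1) p) t k
        = received (H x (endTime n + i) p) t k :=
      fun t ht k => received_run_mono (by omega) (by omega) p k
    unfold treeResult treeSum
    split_ifs with h0
    · congr 1
      refine Finset.sum_congr rfl fun k hk => ?_
      rw [hr _ (upTime_lt_endTime (mem_kids.1 hk).1)]
    · rw [hr _ (downTime_lt_endTime h0)]
  rw [hres, treeResult_of_keyOk (by omega) hp (by omega) (hok p hp).1, claimedKey_eq_sum hclaim]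

/-- Two share vectors that differ in the keys of the other players and in future symbols only. -/
structure SameUntil (d : Fin n) (i : ℕ) (x x' : Fin n → PlayerShare n m N) : Prop where
  dev : x d = x' d
  part : ∀ k, (x k).part = (x' k).part
  tag : ∀ k, (x k).tag = (x' k).tag
  key : ∀ k, (x k).key = (x' k).key
  seq : ∀ k, ∀ i' < i, (x k).seq i' = (x' k).seq i'

theorem SameUntil.devHist_eq {i : ℕ} (h : SameUntil d i x x') {t : ℕ} (ht : t ≤ endTime n + i) :
    H x t = H x' t :=
  Protocol.devHist_congr (P := protocol e deal) h.dev
    (fun t ht k _ _ => send_congr (h.part k) (h.tag k) (fun _ => h.key k)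
      (fun i' hi' => h.seq k i' (by rw [length_run] at hi'; omega))) t ht

theorem SameUntil.ok_iff {i : ℕ} (h : SameUntil d i x x') {t : ℕ} (ht : t ≤ endTime n + i)
    (p : Fin n) : Ok p (x p) (H x t p) ↔ Ok p (x' p) (H x' t p) := by
  rw [h.devHist_eq ht]
  exact ok_congr (h.part p) (h.key p)
    (fun i' hi' => h.seq p i' (by rw [length_run] at hi'; omega))

/-- The first phase does not depend on the keys of the other players and on the symbols. -/
theorem devHist_eq_of_endTime (hd : x d = x' d) (hpart : ∀ k, (x k).part = (x' k).part)
    (htag : ∀ k, (x k).tag = (x' k).tag) {t : ℕ} (ht : t ≤ endTime n) : H x t = H x' t :=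
  Protocol.devHist_congr (P := protocol e deal) hd
    (fun t ht k _ _ => send_congr (hpart k) (htag k)
      (fun h' => by rw [length_run] at h'; omega)
      (fun i' hi' => by rw [length_run] at hi'; omega)) t ht

theorem devSent_eq_of_endTime (hd : x d = x' d) (hpart : ∀ k, (x k).part = (x' k).part)
    (htag : ∀ k, (x k).tag = (x' k).tag) {t : ℕ} (ht : t < endTime n) {k : Fin n} (hk : k ≠ d) :
    Z x t d k = Z x' t d k := by
  have h1 := devHist_eq_of_endTime (e := e) (deal := deal) (σ := σ) hd hpart htag
    (show t + 1 ≤ endTime n by omega)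
  have h2 := received_run (e := e) (deal := deal) (σ := σ) (x := x) (d := d)
    (Nat.lt_succ_self t) hk.symm
  have h3 := received_run (e := e) (deal := deal) (σ := σ) (x := x') (d := d)
    (Nat.lt_succ_self t) hk.symm
  rw [← h2, ← h3, h1]

theorem claimed_eq {b : Bool} (hb : idx b d ≠ 0) (hd : x d = x' d)
    (hpart : ∀ k, (x k).part = (x' k).part) (htag : ∀ k, (x k).tag = (x' k).tag) :
    claimed e deal d σ x b = claimed e deal d σ x' b := by
  unfold claimed
  rw [devSent_eq_of_endTime hd hpart htag (upTime_lt_endTime hb) (par_ne hb)]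

/-- When all other players have stopped, the deviator receives nothing any more. -/
theorem devHist_succ_of_stopped (hn : 2 ≤ n) {T : ℕ} (hT : endTime n ≤ T)
    (hok : ∀ p, p ≠ d → ¬ Ok p (x p) (H x T p)) {t : ℕ} (ht : T ≤ t) :
    H x (t + 1) d = H x t d ++ [fun _ => []] := by
  refine (Protocol.devHist_succ (P := protocol e deal) t d).trans ?_
  congr 2
  funext k
  unfold incoming
  split_ifs with hk
  · rfl
  · rw [sent_eq hk, send_of_not_ok (by rw [length_run]; omega)]
    exact fun h => hok k hk (ok_mono hT ht hn h)

/-- What the deviator sees depends only on what happens before all others have stopped. -/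
theorem SameUntil.devHist_eq_of_stopped (hn : 2 ≤ n) {i : ℕ} (h : SameUntil d i x x')
    (hok : ∀ p, p ≠ d → ¬ Ok p (x p) (H x (endTime n + i) p)) (t : ℕ) :
    H x t d = H x' t d := by
  have hok' : ∀ p, p ≠ d → ¬ Ok p (x' p) (H x' (endTime n + i) p) := fun p hp h' =>
    hok p hp ((h.ok_iff le_rfl p).2 h')
  by_cases ht : t ≤ endTime n + i
  · rw [h.devHist_eq ht]
  · induction t with
    | zero => omega
    | succ t ih =>
      rw [devHist_succ_of_stopped hn (by omega) hok (by omega),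
        devHist_succ_of_stopped hn (by omega) hok' (by omega)]
      by_cases ht' : t ≤ endTime n + i
      · rw [h.devHist_eq ht']
      · rw [ih ht']

end Run

end Player

/-! ### The run in which all players follow the protocol -/

section HonestRun

variable {n m N : ℕ} [NeZero m] [NeZero N] {S : Type} {e : S ≃ ZMod m}
  {deal : S → PMF (Fin n → PlayerShare n m N)} {x : Fin n → PlayerShare n m N}

theorem exists_ne_isLeaf (hn : 3 ≤ n) (b : Bool) (p : Fin n) : ∃ d, d ≠ p ∧ IsLeaf b d := by
  have hi : ∀ q : Fin n, idx b (turn b q) = q.val := fun q => by simp [idx, turn_turn]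
  by_cases h : turn b ⟨n - 1, by omega⟩ = p
  · refine ⟨turn b ⟨n - 2, by omega⟩, fun h' => ?_, ?_⟩
    · have := congrArg (idx b) (h.trans h'.symm)
      rw [hi, hi] at this
      simp only at this
      omega
    · unfold IsLeaf
      rw [hi]
      simp only
      omega
  · refine ⟨_, h, ?_⟩
    unfold IsLeaf
    rw [hi]
    simp only
    omega

theorem claimed_followDev (hn : 2 ≤ n) {b : Bool} {d : Fin n} (hd : IsLeaf b d) :
    claimed e deal d ((protocol e deal).followDev d) x b = ((x d).part, (x d).tag) := by
  unfold claimed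
  rw [Protocol.devSent_followDev]
  refine (congrArg dec (send_up (e := e) (hd.idx_ne_zero hn) ?_)).trans ?_
  · exact Protocol.length_hist (P := protocol e deal) _ _
  · rw [dec_enc]
    simp [treeSum, kids_eq_empty hd]

theorem treeResult_hist (hn : 3 ≤ n) (b : Bool) (p : Fin n) {T : ℕ} (hT : endTime n ≤ T) :
    treeResult b p (x p) ((protocol e deal).hist x T p) = ∑ k, (x k).part := by
  obtain ⟨d, hdp, hd⟩ := exists_ne_isLeaf hn b p
  have h := treeResult_run (e := e) (deal := deal) (σ := (protocol e deal).followDev d) (x := x)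
    (by omega) hd hdp.symm ((downTime_le_endTime b p).trans hT)
  rw [Protocol.devHist_followDev] at h
  rw [h, claimedKey_eq_sum]
  rw [claimed_followDev (by omega) hd]

theorem keyOk_hist (hn : 3 ≤ n)
    (hkey : ∀ k, (x (guardian k)).key k (x k).part = (x k).tag) (p : Fin n) {T : ℕ}
    (hT : endTime n ≤ T) : KeyOk p (x p) ((protocol e deal).hist x T p) := by
  refine ⟨by rw [treeResult_hist hn _ _ hT, treeResult_hist hn _ _ hT], fun k hk => ?_⟩
  have hleaf := isLeaf_leafTree k
  have h0 := hleaf.idx_ne_zero (by omega : 2 ≤ n)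
  have hkp : k ≠ p := fun h => guardian_ne (by omega) k (hk.trans h.symm)
  have h1 : dec (m := m) (N := N)
      (received ((protocol e deal).hist x T p) (upTime (leafTree k) k) k)
      = ((x k).part, (x k).tag) := by
    rw [Protocol.received_hist ((upTime_lt_endTime h0).trans_le hT) hkp]
    subst hk
    refine (congrArg dec (send_up (e := e) h0 ?_)).trans ?_
    · exact Protocol.length_hist (P := protocol e deal) _ _
    · rw [dec_enc]
      simp [treeSum, kids_eq_empty hleaf]
  rw [h1, ← hk]
  exact (hkey k).symm

/-- As long as the symbols of all players agree, nobody has a reason to stop. -/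
theorem ok_hist (hn : 3 ≤ n) (hkey : ∀ k, (x (guardian k)).key k (x k).part = (x k).tag) {i : ℕ}
    (hseq : ∀ i' < i, ∀ p q, (x p).seq i' = (x q).seq i') (p : Fin n) :
    Ok p (x p) ((protocol e deal).hist x (endTime n + i) p) := by
  induction i using Nat.strong_induction_on generalizing p with
  | _ i ih =>
    refine ⟨keyOk_hist hn hkey p (by omega), fun i' hi' k hk => ?_⟩
    have hlen : ∀ T q, ((protocol e deal).hist x T q).length = T := fun T q =>
      Protocol.length_hist (P := protocol e deal) _ _
    rw [hlen] at hi'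
    rw [Protocol.received_hist hi' hk.1]
    have := ih i' (by omega) (fun j hj => hseq j (by omega)) k
    refine (send_symbol (e := e) (by rw [hlen]; omega) this hk).trans ?_
    rw [hlen, Nat.add_sub_cancel_left, hseq i' (by omega) k p]

theorem not_ok_hist (hn : 3 ≤ n) (hkey : ∀ k, (x (guardian k)).key k (x k).part = (x k).tag)
    {i : ℕ} (hseq : ∀ i' < i, ∀ p q, (x p).seq i' = (x q).seq i')
    (hsplit : ∀ p q, cls p ≠ cls q → (x p).seq i ≠ (x q).seq i) (p : Fin n) {T : ℕ}
    (hT : endTime n + i < T) : ¬ Ok p (x p) ((protocol e deal).hist x T p) := by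
  have hok := ok_hist (e := e) (deal := deal) hn hkey hseq
  have h := not_ok_of_split (e := e) (deal := deal) (d := p)
    (σ := (protocol e deal).followDev p) hn (i := i) (x := x)
    (fun q _ => by rw [Protocol.devHist_followDev]; exact hok q) hsplit (p := p)
  intro hT'
  rw [← Protocol.devHist_followDev (j := p)] at hT'
  exact h (ok_mono (by omega) (by omega) (by omega) hT')

theorem outcome_eq (hn : 3 ≤ n) (hkey : ∀ k, (x (guardian k)).key k (x k).part = (x k).tag)
    {i : ℕ} (hseq : ∀ i' < i, ∀ p q, (x p).seq i' = (x q).seq i')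
    (hsplit : ∀ p q, cls p ≠ cls q → (x p).seq i ≠ (x q).seq i) (s : S) :
    (protocol e deal).outcome s x =
      (s, fun _ => some (e.symm (∑ k, (x k).part + (i : ZMod m)))) := by
  unfold Protocol.outcome
  congr 1
  funext p
  obtain ⟨d, hdp, -⟩ := exists_ne_isLeaf hn true p
  have h := firstOutput_of_split (e := e) (deal := deal) (d := d)
    (σ := (protocol e deal).followDev d) hn (i := i) (x := x)
    (fun q _ => by
      rw [Protocol.devHist_followDev]; exact ok_hist (e := e) (deal := deal) hn hkey hseq q)
    hsplit (by rw [claimed_followDev (by omega) (isLeaf_leafTree d)]) hdp.symm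
  simp only [Protocol.devHist_followDev] at h
  exact h

end HonestRun

/-! ### Expectations with respect to discrete distributions -/

section Expectation

variable {α β : Type}

/-- The expectation of a (bounded) function under a discrete distribution. -/
def expectation (p : PMF α) (f : α → ℝ) : ℝ := ∑' a, (p a).toReal * f a

theorem summable_toReal (p : PMF α) : Summable fun a => (p a).toReal :=
  ENNReal.summable_toReal p.tsum_coe_ne_top

theorem summable_toReal_mul (p : PMF α) {f : α → ℝ} {B : ℝ} (hf : ∀ a, |f a| ≤ B) :
    Summable fun a => (p a).toReal * f a := by
  refine Summable.of_norm_bounded ((summable_toReal p).mul_right B) fun a => ?_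
  rw [Real.norm_eq_abs, abs_mul, abs_of_nonneg ENNReal.toReal_nonneg]
  exact mul_le_mul_of_nonneg_left (hf a) ENNReal.toReal_nonneg

theorem expectation_pure (a : α) (f : α → ℝ) : expectation (PMF.pure a) f = f a := by
  unfold expectation
  rw [tsum_eq_single a]
  · simp
  · intro b hb
    simp [hb]

theorem expectation_bind (p : PMF α) (q : α → PMF β) {f : β → ℝ} {B : ℝ} (hf : ∀ b, |f b| ≤ B) :
    expectation (p.bind q) f = expectation p fun a => expectation (q a) f := by
  have hsum : ∑' ab : α × β, p ab.1 * q ab.1 ab.2 = 1 := by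
    rw [ENNReal.tsum_prod']
    simp only [ENNReal.tsum_mul_left, PMF.tsum_coe, mul_one]
  have hS : Summable fun ab : α × β => (p ab.1).toReal * (q ab.1 ab.2).toReal * f ab.2 := by
    have h1 : Summable fun ab : α × β => (p ab.1 * q ab.1 ab.2).toReal :=
      ENNReal.summable_toReal (by rw [hsum]; exact ENNReal.one_ne_top)
    refine Summable.of_norm_bounded (h1.mul_right B) fun ab => ?_
    rw [Real.norm_eq_abs, abs_mul, ENNReal.toReal_mul, abs_of_nonneg (by positivity)]
    exact mul_le_mul_of_nonneg_left (hf _) (by positivity)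
  unfold expectation
  calc ∑' b, (p.bind q b).toReal * f b
      = ∑' b, ∑' a, (p a).toReal * (q a b).toReal * f b := by
        refine tsum_congr fun b => ?_
        rw [PMF.bind_apply, ENNReal.tsum_toReal_eq, ← tsum_mul_right]
        · simp only [ENNReal.toReal_mul]
        · exact fun a => ENNReal.mul_ne_top (PMF.apply_ne_top _ _) (PMF.apply_ne_top _ _)
    _ = ∑' a, ∑' b, (p a).toReal * (q a b).toReal * f b := Summable.tsum_comm hS
    _ = _ := by
        refine tsum_congr fun a => ?_
        rw [← tsum_mul_left]
        simp only [mul_assoc]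

theorem expectation_map (p : PMF α) (g : α → β) {f : β → ℝ} {B : ℝ} (hf : ∀ b, |f b| ≤ B) :
    expectation (p.map g) f = expectation p fun a => f (g a) := by
  rw [PMF.map, expectation_bind p _ hf]
  simp only [Function.comp_def, expectation_pure]

theorem expectation_uniformOfFinset [Fintype α] (s : Finset α) (hs : s.Nonempty) (f : α → ℝ) :
    expectation (PMF.uniformOfFinset s hs) f = (s.card : ℝ)⁻¹ * ∑ a ∈ s, f a := by
  classical
  unfold expectation
  rw [tsum_fintype, Finset.mul_sum, ← Finset.sum_filter_add_sum_filter_not Finset.univ (· ∈ s)]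
  rw [Finset.sum_eq_zero (s := Finset.univ.filter fun a => ¬ a ∈ s), add_zero]
  · have : Finset.univ.filter (· ∈ s) = s := by ext; simp
    rw [this]
    refine Finset.sum_congr rfl fun a ha => ?_
    rw [PMF.uniformOfFinset_apply_of_mem hs ha]
    simp
  · intro a ha
    rw [PMF.uniformOfFinset_apply_of_notMem hs (by simpa using ha)]
    simp

theorem expectation_uniformOfFintype [Fintype α] [Nonempty α] (f : α → ℝ) :
    expectation (PMF.uniformOfFintype α) f = (Fintype.card α : ℝ)⁻¹ * ∑ a, f a :=
  expectation_uniformOfFinset _ _ _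

end Expectation

/-! ### The dealer -/

section Dealer

variable {n m N : ℕ}

/-- The shares made from the contributions to the joint key, the keys of all authentication tags
and the sequences of symbols of the three classes. -/
def shares (r : Fin n → ZMod m) (κ : Fin n → ZMod m → ZMod N) (t : SeqTriple) (p : Fin n) :
    PlayerShare n m N where
  part := r p
  tag := κ p (r p)
  key k := if guardian k = p then κ k else 0
  seq := t (cls p)

theorem shares_key (r : Fin n → ZMod m) (κ : Fin n → ZMod m → ZMod N) (t : SeqTriple)
    (k : Fin n) : (shares r κ t (guardian k)).key k = κ k := by
  simp [shares]

/-- What all players following the protocol would be dealt if the symbols of all classes were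
the given ones: as long as nobody has noticed a difference, the deviator cannot tell these shares
from the true ones. -/
def common (r : Fin n → ZMod m) (κ : Fin n → ZMod m → ZMod N) (l : SymSeq) :
    Fin n → PlayerShare n m N :=
  shares r κ fun _ => l

/-- The possible values of the split number and the symbols. -/
def Splits (L : ℕ × SeqTriple) : Prop :=
  (∀ i < L.1, ∀ c c', L.2 c i = L.2 c' i) ∧ ∀ c c', c ≠ c' → L.2 c L.1 ≠ L.2 c' L.1

variable {d : Fin n} {r : Fin n → ZMod m} {κ : Fin n → ZMod m → ZMod N} {L : ℕ × SeqTriple}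
  {l : SymSeq}

theorem sameUntil_common (hL : Splits L) :
    SameUntil d L.1 (common r κ (L.2 (cls d))) (shares r κ L.2) where
  dev := rfl
  part _ := rfl
  tag _ := rfl
  key _ := rfl
  seq _ i hi := hL.1 i hi _ _

theorem common_update_apply (hn : 2 ≤ n) {f : ZMod m → ZMod N} (hf : f (r d) = κ d (r d)) :
    common r (Function.update κ d f) l d = common r κ l d := by
  unfold common shares
  congr 1
  · simp [hf]
  · funext k
    split_ifs with hk
    · rw [Function.update_of_ne]
      rintro rfl
      exact guardian_ne hn _ hk
    · rfl

theorem tag_common_update {f : ZMod m → ZMod N} (hf : f (r d) = κ d (r d)) (k : Fin n) :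
    (common r (Function.update κ d f) l k).tag = (common r κ l k).tag := by
  simp only [common, shares]
  by_cases hk : k = d
  · subst hk; simp [hf]
  · rw [Function.update_of_ne hk]

variable [NeZero m] [NeZero N]

/-- The contribution vectors with a given joint key. -/
def keyFiber (n : ℕ) (g : ZMod m) : Finset (Fin n → ZMod m) :=
  Finset.univ.filter fun r => ∑ k, r k = g

theorem mem_keyFiber {g : ZMod m} {r : Fin n → ZMod m} : r ∈ keyFiber n g ↔ ∑ k, r k = g := by
  simp [keyFiber]

theorem keyFiber_nonempty [NeZero n] (g : ZMod m) : (keyFiber n g).Nonempty :=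
  ⟨Pi.single 0 g, by rw [mem_keyFiber]; simp⟩

theorem map_keyFiber (j : Fin n) (g g' : ZMod m) :
    (keyFiber n g).map (Equiv.addRight (Pi.single j (g' - g) : Fin n → ZMod m)).toEmbedding
      = keyFiber n g' := by
  ext r
  simp only [Finset.mem_map_equiv, mem_keyFiber, Equiv.addRight_symm, Equiv.coe_addRight]
  rw [← sub_eq_add_neg]
  simp only [Pi.sub_apply, Finset.sum_sub_distrib, Finset.sum_pi_single', Finset.mem_univ, if_true]
  constructor <;> intro h
  · linear_combination h
  · linear_combination h

theorem card_keyFiber [NeZero n] (g : ZMod m) :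
    (keyFiber n g).card = (keyFiber n (0 : ZMod m)).card := by
  rw [← map_keyFiber 0 g 0, Finset.card_map]

variable [NeZero n] {S : Type}

/-- The dealer: the joint key is the secret minus the (random) number of the candidate that will
be output. -/
def dealer (n N : ℕ) [NeZero n] [NeZero N] (e : S ≃ ZMod m) (law : PMF (ℕ × SeqTriple)) (s : S) :
    PMF (Fin n → PlayerShare n m N) :=
  law.bind fun L =>
    (PMF.uniformOfFinset (keyFiber n (e s - (L.1 : ZMod m))) (keyFiber_nonempty _)).bind fun r =>
      (PMF.uniformOfFintype (Fin n → ZMod m → ZMod N)).map fun κ => shares r κ L.2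

theorem mem_support_dealer {e : S ≃ ZMod m} {law : PMF (ℕ × SeqTriple)} {s : S}
    {x : Fin n → PlayerShare n m N} (hx : x ∈ (dealer n N e law s).support) :
    ∃ L ∈ law.support, ∃ r : Fin n → ZMod m, ∃ κ, ∑ k, r k + L.1 = e s ∧ x = shares r κ L.2 := by
  simp only [dealer, PMF.mem_support_bind_iff, PMF.mem_support_uniformOfFinset_iff, mem_keyFiber,
    PMF.mem_support_map_iff] at hx
  obtain ⟨L, hL, r, hr, κ, -, rfl⟩ := hx
  exact ⟨L, hL, r, κ, by rw [hr]; ring, rfl⟩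

theorem map_uniformOfFinset {α : Type} [DecidableEq α] (f : α ↪ α) (s : Finset α)
    (hs : s.Nonempty) :
    (PMF.uniformOfFinset s hs).map f = PMF.uniformOfFinset (s.map f) (by simpa using hs) := by
  ext a
  rw [PMF.map_apply]
  by_cases ha : ∃ b, f b = a
  · obtain ⟨b, rfl⟩ := ha
    rw [tsum_eq_single b]
    · simp [PMF.uniformOfFinset_apply]
    · intro c hc
      rw [if_neg (fun h => hc (f.injective h).symm)]
  · rw [PMF.uniformOfFinset_apply_of_notMem]
    · rw [ENNReal.tsum_eq_zero]
      intro b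
      rw [if_neg (fun h => ha ⟨b, h.symm⟩)]
    · simp only [Finset.mem_map, not_exists, not_and]
      exact fun b _ h => ha ⟨b, h⟩

/-- Changing the contribution of a player outside of `T` turns the sharings of one secret into
those of another one, but it also changes the value that is authenticated by his tag. As his tag
is not seen by `T` either, this makes no difference to `T`. -/
theorem secrecy_dealer (e : S ≃ ZMod m) (law : PMF (ℕ × SeqTriple)) :
    (protocol e (dealer n N e law)).Secrecy := by
  classical
  intro T hT s s'
  obtain ⟨j, hj⟩ : ∃ j, j ∉ T := by
    by_contra! h
    exact hT (Finset.eq_univ_iff_forall.2 h)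
  simp only [dealer, PMF.map_bind, PMF.map_comp]
  congr 1
  funext L
  have hmap := map_uniformOfFinset
    (Equiv.addRight (Pi.single j ((e s' - (L.1 : ZMod m)) - (e s - (L.1 : ZMod m))) :
      Fin n → ZMod m)).toEmbedding
    (keyFiber n (e s - (L.1 : ZMod m))) (keyFiber_nonempty _)
  simp only [map_keyFiber] at hmap
  rw [← hmap, PMF.bind_map]
  congr 1
  funext r
  simp only [Function.comp_def]
  congr 1
  funext κ i
  have hi : (i : Fin n) ≠ j := fun h => hj (h ▸ i.2)
  simp [shares, hi]

theorem expect_dealer [Fintype S] (e : S ≃ ZMod m) (law : PMF (ℕ × SeqTriple)) :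
    ∃ w : ℝ, 0 < w ∧ ∀ (f : S → (Fin n → PlayerShare n m N) → ℝ) (B : ℝ),
      (∀ s x, |f s x| ≤ B) →
      (protocol e (dealer n N e law)).expect f = w * expectation law fun L =>
        ∑ r : Fin n → ZMod m, ∑ κ : Fin n → ZMod m → ZMod N,
          f (e.symm (∑ k, r k + L.1)) (shares r κ L.2) := by
  classical
  set c₁ : ℝ := ((keyFiber n (0 : ZMod m)).card : ℝ)⁻¹
  set c₂ : ℝ := (Fintype.card (Fin n → ZMod m → ZMod N) : ℝ)⁻¹
  have hS : 0 < (Fintype.card S : ℝ) := by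
    rw [Fintype.card_congr e, ZMod.card]
    exact_mod_cast Nat.pos_of_ne_zero (NeZero.ne m)
  have h1 : 0 < c₁ := by
    have := (keyFiber_nonempty (n := n) (0 : ZMod m)).card_pos
    positivity
  have h2 : 0 < c₂ := by
    have : 0 < Fintype.card (Fin n → ZMod m → ZMod N) := Fintype.card_pos
    positivity
  refine ⟨c₁ * c₂ / Fintype.card S, by positivity, fun f B hf => ?_⟩
  have hx : ∀ s, ∑' x, (dealer n N e law s x).toReal * f s x
      = expectation law fun L => c₁ * (c₂ * ∑ r ∈ keyFiber n (e s - (L.1 : ZMod m)),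
          ∑ κ, f s (shares r κ L.2)) := by
    intro s
    change expectation (dealer n N e law s) (f s) = _
    unfold dealer
    rw [expectation_bind _ _ (hf s)]
    congr 1
    funext L
    rw [expectation_bind _ _ (hf s), expectation_uniformOfFinset, card_keyFiber,
      Finset.mul_sum _ _ c₂]
    congr 1
    refine Finset.sum_congr rfl fun r _ => ?_
    rw [expectation_map _ _ (hf s), expectation_uniformOfFintype]
  have hbound : ∀ (L : ℕ × SeqTriple) (s : S),
      |c₁ * (c₂ * ∑ r ∈ keyFiber n (e s - (L.1 : ZMod m)), ∑ κ : Fin n → ZMod m → ZMod N,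
        f s (shares r κ L.2))|
      ≤ c₁ * (c₂ * ∑ r : Fin n → ZMod m, ∑ κ : Fin n → ZMod m → ZMod N, B) := by
    intro L s
    rw [abs_mul, abs_mul, abs_of_pos h1, abs_of_pos h2]
    gcongr
    refine (Finset.abs_sum_le_sum_abs _ _).trans ((Finset.sum_le_sum fun r _ =>
      (Finset.abs_sum_le_sum_abs _ _).trans (Finset.sum_le_sum fun κ _ => hf _ _)).trans ?_)
    refine Finset.sum_le_sum_of_subset_of_nonneg (Finset.subset_univ _) fun r _ _ =>
      Finset.sum_nonneg fun κ _ => (abs_nonneg _).trans (hf s (shares r κ L.2))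
  unfold Protocol.expect
  simp only [hx]
  have hcomm : ∑ s, expectation law (fun L => c₁ * (c₂ * ∑ r ∈ keyFiber n (e s - (L.1 : ZMod m)),
          ∑ κ, f s (shares r κ L.2)))
      = c₁ * c₂ * expectation law fun L =>
        ∑ r : Fin n → ZMod m, ∑ κ : Fin n → ZMod m → ZMod N,
          f (e.symm (∑ k, r k + L.1)) (shares r κ L.2) := by
    unfold expectation
    rw [← Summable.tsum_finsetSum fun s _ => summable_toReal_mul law (fun L => hbound L s),
      ← tsum_mul_left]
    refine tsum_congr fun L => ?_
    rw [← Finset.mul_sum, ← Finset.mul_sum, ← Finset.mul_sum]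
    have hfib : ∑ s, ∑ r ∈ keyFiber n (e s - (L.1 : ZMod m)), ∑ κ : Fin n → ZMod m → ZMod N,
        f s (shares r κ L.2) = ∑ r : Fin n → ZMod m, ∑ κ : Fin n → ZMod m → ZMod N,
          f (e.symm (∑ k, r k + L.1)) (shares r κ L.2) := by
      rw [← Finset.sum_fiberwise Finset.univ
        (fun r : Fin n → ZMod m => e.symm (∑ k, r k + L.1))]
      refine Finset.sum_congr rfl fun s _ => ?_
      have hset : keyFiber n (e s - (L.1 : ZMod m)) = Finset.univ.filter
          fun r : Fin n → ZMod m => e.symm (∑ k, r k + L.1) = s := by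
        ext r
        rw [mem_keyFiber, Finset.mem_filter, Equiv.symm_apply_eq, eq_sub_iff_add_eq]
        simp
      rw [hset]
      refine Finset.sum_congr rfl fun r hr => ?_
      rw [(Finset.mem_filter.1 hr).2]
    rw [hfib]
    ring
  rw [hcomm]
  ring

end Dealer

/-! ### Utilities -/

section Gap

variable {n : ℕ} {S : Type}

/-- What the argument needs to know about the utility function `u` of player `j`: if `Δ` is the gap
between the worst outcome in which `j` learns the secret and the best one in which he does not, then
an outcome is better than one in which `j` learns the secret by `G * Δ` at most, and it is worse by
at least `Δ` if `j` does not learn the secret in it. -/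
structure HasGap (u : Outcome n S → ℝ) (j : Fin n) (G Δ : ℝ) : Prop where
  pos : 0 < Δ
  le_of_learns : ∀ o o', j ∈ learners o' → u o - u o' ≤ G * Δ
  le_of_not_learns : ∀ o o', j ∉ learners o → j ∈ learners o' → u o - u o' ≤ -Δ

theorem exists_hasGap [Finite S] [Nonempty S] {u : Utility n S} (hu : u.LearningPreferring)
    {U : ℝ} (hU1 : 1 ≤ U) (hU : u.ratio ≤ U) (j : Fin n) : ∃ Δ, HasGap (u j) j (U - 1) Δ := by
  have hfin : ∀ s : Set (Outcome n S), (u j '' s).Finite := fun s => s.toFinite.image _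
  obtain ⟨s⟩ := ‹Nonempty S›
  have h1 : (u j '' {o | j ∈ learners o}).Nonempty :=
    ⟨_, (s, fun _ => some s), rfl, rfl⟩
  have h2 : (u j '' {o | j ∉ learners o}).Nonempty :=
    ⟨_, (s, fun _ => none), fun h => Option.some_ne_none s h.symm, rfl⟩
  have hlt : u.bestNotLearning j < u.worstLearning j := by
    obtain ⟨o, ho, h⟩ := h1.csInf_mem (hfin _)
    obtain ⟨o', ho', h'⟩ := h2.csSup_mem (hfin _)
    unfold Utility.bestNotLearning Utility.worstLearning
    rw [← h, ← h']
    exact hu j o o' ho ho'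
  have hb : ∀ o, j ∈ learners o → u j o ≤ u.bestLearning j := fun o ho =>
    le_csSup (hfin _).bddAbove ⟨o, ho, rfl⟩
  have hw : ∀ o, j ∈ learners o → u.worstLearning j ≤ u j o := fun o ho =>
    csInf_le (hfin _).bddBelow ⟨o, ho, rfl⟩
  have hn : ∀ o, j ∉ learners o → u j o ≤ u.bestNotLearning j := fun o ho =>
    le_csSup (hfin _).bddAbove ⟨o, ho, rfl⟩
  have hr : u.bestLearning j - u.bestNotLearning j
      ≤ U * (u.worstLearning j - u.bestNotLearning j) := by
    rw [← div_le_iff₀ (by linarith)]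
    exact (le_ciSup (f := fun j : Fin n => (u.bestLearning j - u.bestNotLearning j) /
      (u.worstLearning j - u.bestNotLearning j)) (Set.finite_range _).bddAbove j).trans hU
  refine ⟨u.worstLearning j - u.bestNotLearning j, by linarith, fun o o' ho' => ?_,
    fun o o' ho ho' => ?_⟩
  · have h4 := hw o' ho'
    by_cases ho : j ∈ learners o
    · have h3 := hb o ho
      linarith
    · have h3 := hn o ho
      nlinarith
  · have h3 := hn o ho
    have h4 := hw o' ho'
    linarith

end Gap

/-! ### What a deviator can gain for given symbols and keys -/

section Gain

variable {n m N : ℕ} [NeZero m] [NeZero N] {S : Type} (e : S ≃ ZMod m)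
  (deal : S → PMF (Fin n → PlayerShare n m N)) (d : Fin n)
  (σ : Strategy n S (PlayerShare n m N)) (x : Fin n → PlayerShare n m N)

/-- The final output of the deviator. -/
def devGuess : Option S :=
  firstOutput fun t => σ.output (x d) ((protocol e deal).devHist d σ x t d)

/-- At least one of the other players has stopped before the `i`-th symbols are sent. -/
def Harm (i : ℕ) : Prop :=
  ∃ p, p ≠ d ∧ ¬ Ok p (x p) ((protocol e deal).devHist d σ x (endTime n + i) p)

/-- The numbers of the candidates for which the output of the deviator would be right, if the
joint key is `g`. -/
def winning (g : ZMod m) : Set ℕ := {i | devGuess e deal d σ x = some (e.symm (g + i))}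

variable {e deal d σ x}

theorem mem_learners_devOutcome {s : S} :
    d ∈ learners ((protocol e deal).devOutcome d σ s x) ↔ devGuess e deal d σ x = some s := by
  simp [learners, Protocol.devOutcome, devGuess]

theorem Harm.mono (hn : 2 ≤ n) {i i' : ℕ} (h : Harm e deal d σ x i) (hi : i ≤ i') :
    Harm e deal d σ x i' := by
  obtain ⟨p, hp, hok⟩ := h
  exact ⟨p, hp, fun h' => hok (ok_mono (by omega) (by omega) hn h')⟩

theorem winning_gap {g : ZMod m} {M : ℕ} (hM : M ≤ m) :
    ∀ i ∈ winning e deal d σ x g, ∀ i' ∈ winning e deal d σ x g, i < i' → i + M ≤ i' := by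
  intro i hi i' hi' hlt
  have h1 : some (e.symm (g + i)) = some (e.symm (g + i')) := hi.symm.trans hi'
  have h2 : (i : ZMod m) = i' := add_left_cancel (e.symm.injective (Option.some_injective _ h1))
  rw [ZMod.natCast_eq_natCast_iff, Nat.modEq_iff_dvd' hlt.le] at h2
  have := Nat.le_of_dvd (by omega) h2
  omega

variable {r : Fin n → ZMod m} {κ : Fin n → ZMod m → ZMod N} {L : ℕ × SeqTriple} {l : SymSeq}

theorem outcome_shares (hn : 3 ≤ n) (hL : Splits L) (s : S) :
    (protocol e deal).outcome s (shares r κ L.2) =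
      (s, fun _ => some (e.symm (∑ k, r k + (L.1 : ZMod m)))) :=
  outcome_eq hn (fun k => by rw [shares_key]; rfl) (fun i hi p q => hL.1 i hi _ _)
    (fun p q h => hL.2 _ _ h) s

variable (u : Outcome n S → ℝ) (e deal d σ x) in
/-- What the deviator gains if the secret is `s`. -/
def gain (s : S) : ℝ :=
  u ((protocol e deal).devOutcome d σ s x) - u ((protocol e deal).outcome s x)

variable {u : Outcome n S → ℝ} {G Δ : ℝ}

theorem gain_le (hn : 3 ≤ n) (hu : HasGap u d G Δ) (hL : Splits L) :
    gain e deal d σ (shares r κ L.2) u (e.symm (∑ k, r k + L.1)) ≤ G * Δ :=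
  hu.le_of_learns _ _ (by rw [outcome_shares hn hL]; rfl)

theorem gain_le_neg (hn : 3 ≤ n) (hu : HasGap u d G Δ) (hL : Splits L)
    (h : devGuess e deal d σ (shares r κ L.2) ≠ some (e.symm (∑ k, r k + L.1))) :
    gain e deal d σ (shares r κ L.2) u (e.symm (∑ k, r k + L.1)) ≤ -Δ :=
  hu.le_of_not_learns _ _ (fun h' => h (mem_learners_devOutcome.1 h'))
    (by rw [outcome_shares hn hL]; rfl)

/-- A deviator who claims his true contribution and does not make anybody stop too early cannot
prevent the others from learning the secret. -/
theorem gain_nonpos (hn : 3 ≤ n) (hu : HasGap u d G Δ) (hL : Splits L)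
    (hauth : (claimed e deal d σ (common r κ (L.2 (cls d))) (leafTree d)).1 = r d)
    (hharm : ¬ Harm e deal d σ (common r κ (L.2 (cls d))) L.1) :
    gain e deal d σ (shares r κ L.2) u (e.symm (∑ k, r k + L.1)) ≤ 0 := by
  by_cases h : devGuess e deal d σ (shares r κ L.2) = some (e.symm (∑ k, r k + L.1))
  · have hsame : SameUntil d L.1 (common r κ (L.2 (cls d))) (shares r κ L.2) :=
      sameUntil_common hL
    have hout : (protocol e deal).devOutcome d σ (e.symm (∑ k, r k + L.1)) (shares r κ L.2)
        = (protocol e deal).outcome (e.symm (∑ k, r k + L.1)) (shares r κ L.2) := by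
      rw [outcome_shares hn hL]
      unfold Protocol.devOutcome
      congr 1
      funext p
      by_cases hp : p = d
      · subst hp
        simpa [devGuess] using h
      · rw [Function.update_of_ne hp]
        refine firstOutput_of_split hn (fun q hq => ?_) (fun p q h => hL.2 _ _ h) ?_ hp
        · rw [← hsame.ok_iff le_rfl]
          by_contra hok
          exact hharm ⟨q, hq, hok⟩
        · rw [← claimed_eq ((isLeaf_leafTree d).idx_ne_zero (by omega)) hsame.dev hsame.part
            hsame.tag]
          exact hauth
    unfold gain
    rw [hout, sub_self]
  · exact (gain_le_neg hn hu hL h).trans (neg_nonpos.2 hu.pos.le)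

/-- Once a player has stopped, all stop soon, and from then on the deviator learns nothing about
the split number, so that his guess is right for the numbers in one residue class only. -/
theorem gain_le_balance (hn : 3 ≤ n) (hu : HasGap u d G Δ) (hL : Splits L) {I : ℕ}
    (hharm : Harm e deal d σ (common r κ (L.2 (cls d))) I) (hI : I ≤ L.1) :
    gain e deal d σ (shares r κ L.2) u (e.symm (∑ k, r k + L.1)) ≤ Δ * balance G (2 * height n) I
      (winning e deal d σ (common r κ (L.2 (cls d))) (∑ k, r k)) L.1 := by
  unfold balance
  rw [if_neg (by omega)]
  split_ifs with h1 h2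
  · rw [mul_comm]; exact gain_le hn hu hL
  · rw [mul_comm]; exact gain_le hn hu hL
  · rw [mul_neg_one]
    refine gain_le_neg hn hu hL fun h => h2 ?_
    have hsame : SameUntil d L.1 (common r κ (L.2 (cls d))) (shares r κ L.2) :=
      sameUntil_common hL
    obtain ⟨p, hp, hok⟩ := hharm
    have hall : ∀ q, q ≠ d → ¬ Ok q (common r κ (L.2 (cls d)) q)
        ((protocol e deal).devHist d σ (common r κ (L.2 (cls d))) (endTime n + L.1) q) :=
      fun q hq h' => not_ok_spread (by omega) (by omega) hp hq hok
        (ok_mono (by omega) (by omega) (by omega) h')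
    change devGuess e deal d σ _ = _
    rw [← h]
    unfold devGuess
    congr 1
    funext t
    rw [← hsame.dev, hsame.devHist_eq_of_stopped (by omega) hall]

/-- A forged contribution with a wrong tag makes the guardian stop at once. -/
theorem harm_of_not_forged (hn : 2 ≤ n)
    (h : (claimed e deal d σ (common r κ l) (leafTree d)).2 ≠
      κ d (claimed e deal d σ (common r κ l) (leafTree d)).1) :
    Harm e deal d σ (common r κ l) 0 := by
  refine ⟨guardian d, guardian_ne hn d, fun hok => h ?_⟩
  have := tag_of_keyOk hn (by omega) hok.1
  rwa [show (common r κ l (guardian d)).key d = κ d from shares_key r κ _ d] at this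

open Classical in
variable (e deal d σ) in
/-- A bound for the gain of the deviator, in units of the gap, in dependence of the split
number `i`. -/
def gainBound (Ev : Set (Fin n → PlayerShare n m N)) (G : ℝ) (r : Fin n → ZMod m)
    (κ : Fin n → ZMod m → ZMod N) (l : SymSeq) (i : ℕ) : ℝ :=
  if common r κ l ∈ Ev then
    if (claimed e deal d σ (common r κ l) (leafTree d)).1 = r d then
      if h : ∃ I, Harm e deal d σ (common r κ l) I then
        balance G (2 * height n) (Nat.find h) (winning e deal d σ (common r κ l) (∑ k, r k)) i
      else 0
    else if (claimed e deal d σ (common r κ l) (leafTree d)).2 =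
      κ d (claimed e deal d σ (common r κ l) (leafTree d)).1 then G
    else balance G (2 * height n) 0 (winning e deal d σ (common r κ l) (∑ k, r k)) i
  else 0

theorem abs_balance_le {G : ℝ} (hG : 0 ≤ G) (B I : ℕ) (A : Set ℕ) (i : ℕ) :
    |balance G B I A i| ≤ G + 1 := by
  unfold balance
  split_ifs <;> rw [abs_le] <;> constructor <;> linarith

theorem abs_gainBound_le {Ev : Set (Fin n → PlayerShare n m N)} (hG : 0 ≤ G) (i : ℕ) :
    |gainBound e deal d σ Ev G r κ l i| ≤ G + 1 := by
  unfold gainBound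
  split_ifs
  · exact abs_balance_le hG _ _ _ _
  · rw [abs_zero]; linarith
  · rw [abs_of_nonneg hG]; linarith
  · exact abs_balance_le hG _ _ _ _
  · rw [abs_zero]; linarith

variable (e deal d σ) in
/-- An event that the deviator can observe, as far as the argument needs it. If he makes somebody
stop before the split or claims a false contribution, so that he may gain something, then the event
does not depend on the symbols of the others. If he claims a false contribution, then it does not
depend on the values of the key that a forged tag would have to fit. -/
structure Observable (Ev : Set (Fin n → PlayerShare n m N)) : Prop where
  common_iff : ∀ (r : Fin n → ZMod m) (κ : Fin n → ZMod m → ZMod N) (L : ℕ × SeqTriple), Splits L →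
    ((claimed e deal d σ (common r κ (L.2 (cls d))) (leafTree d)).1 ≠ r d ∨
      Harm e deal d σ (common r κ (L.2 (cls d))) L.1) →
    (shares r κ L.2 ∈ Ev ↔ common r κ (L.2 (cls d)) ∈ Ev)
  update_iff : ∀ (r : Fin n → ZMod m) (κ : Fin n → ZMod m → ZMod N) (l : SymSeq)
    (f : ZMod m → ZMod N), (claimed e deal d σ (common r κ l) (leafTree d)).1 ≠ r d →
    f (r d) = κ d (r d) →
    (common r κ l ∈ Ev ↔ common r (Function.update κ d f) l ∈ Ev)

theorem indicator_gain_le (hn : 3 ≤ n) (hu : HasGap u d G Δ) (hL : Splits L)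
    {Ev : Set (Fin n → PlayerShare n m N)} (hEv : Observable e deal d σ Ev) :
    Ev.indicator (fun x => gain e deal d σ x u (e.symm (∑ k, r k + L.1))) (shares r κ L.2)
      ≤ Δ * gainBound e deal d σ Ev G r κ (L.2 (cls d)) L.1 := by
  classical
  have h1 := hEv.common_iff r κ L hL
  by_cases hauth : (claimed e deal d σ (common r κ (L.2 (cls d))) (leafTree d)).1 = r d
  · by_cases hharm : Harm e deal d σ (common r κ (L.2 (cls d))) L.1
    · have h2 := h1 (Or.inr hharm)
      by_cases hmem : common r κ (L.2 (cls d)) ∈ Ev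
      · rw [Set.indicator_of_mem (h2.2 hmem)]
        have hex : ∃ I, Harm e deal d σ (common r κ (L.2 (cls d))) I := ⟨_, hharm⟩
        simp only [gainBound, hmem, if_true, hauth, hex, dif_pos]
        exact gain_le_balance hn hu hL (Nat.find_spec hex) (Nat.find_min' hex hharm)
      · rw [Set.indicator_of_notMem (fun h => hmem (h2.1 h))]
        simp [gainBound, hmem]
    · have hle : Ev.indicator (fun x => gain e deal d σ x u (e.symm (∑ k, r k + L.1)))
          (shares r κ L.2) ≤ 0 :=
        Set.indicator_apply_le' (fun _ => gain_nonpos hn hu hL hauth hharm) fun _ => le_rfl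
      refine hle.trans (mul_nonneg hu.pos.le (le_of_eq ?_))
      unfold gainBound
      split_ifs with _ hex
      · have : L.1 < Nat.find hex := by
          by_contra hlt
          exact hharm ((Nat.find_spec hex).mono (by omega) (not_lt.1 hlt))
        simp [balance, this]
      · rfl
      · rfl
  · have h2 := h1 (Or.inl hauth)
    by_cases hmem : common r κ (L.2 (cls d)) ∈ Ev
    · rw [Set.indicator_of_mem (h2.2 hmem)]
      simp only [gainBound, hmem, if_true, hauth, if_false]
      split_ifs with hforged
      · rw [mul_comm]; exact gain_le hn hu hL
      · exact gain_le_balance hn hu hL (harm_of_not_forged (by omega) hforged) (Nat.zero_le _)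
    · rw [Set.indicator_of_notMem (fun h => hmem (h2.1 h))]
      simp [gainBound, hmem]

/-! ### Averaging over the keys -/

theorem claimed_update (hn : 2 ≤ n) {f : ZMod m → ZMod N} (hf : f (r d) = κ d (r d)) :
    claimed e deal d σ (common r (Function.update κ d f) l) (leafTree d)
      = claimed e deal d σ (common r κ l) (leafTree d) :=
  claimed_eq ((isLeaf_leafTree d).idx_ne_zero hn) (common_update_apply hn hf) (fun _ => rfl)
    (tag_common_update hf)

theorem sum_nonpos_of_shift {α : Type} [Fintype α] {T : ZMod N → α → α}
    (hT : ∀ y a, T (-y) (T y a) = a) {F : α → ℝ} (h : ∀ a, ∑ y, F (T y a) ≤ 0) :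
    ∑ a, F a ≤ 0 := by
  have h1 : ∀ y, ∑ a, F (T y a) = ∑ a, F a := fun y =>
    Equiv.sum_comp ⟨T y, T (-y), hT y, fun a => by
      have := hT (-y) a
      rwa [neg_neg] at this⟩ F
  have h2 : ∑ y : ZMod N, ∑ a, F (T y a) ≤ 0 := by
    rw [Finset.sum_comm]
    exact Finset.sum_nonpos fun a _ => h a
  simp only [h1, Finset.sum_const, Finset.card_univ, ZMod.card, nsmul_eq_mul] at h2
  have hN : (0 : ℝ) < N := by exact_mod_cast Nat.pos_of_ne_zero (NeZero.ne N)
  exact nonpos_of_mul_nonpos_right h2 hN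

/-- Whatever a deviator does who claims a false contribution, the value of the key that his tag
has to fit is uniformly distributed from his point of view. -/
theorem sum_gainBound_nonpos (hn : 3 ≤ n) {η δ c : ℝ} {M : ℕ} {W : ℕ → ℝ}
    (hW : SlowlyDecreasing η W) (h0 : 0 < η) (h1 : η ≤ 1) (hG : 0 ≤ G) (hδ0 : 0 < δ) (hM : M ≤ m)
    (hc : 1 ≤ c * (M * (1 - η) ^ M)) (hδ : (G + 1) * ((2 * height n : ℕ) * η + c) ≤ 1 - δ)
    (hN : G ≤ (N - 1) * δ) {Ev : Set (Fin n → PlayerShare n m N)}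
    (hEv : Observable e deal d σ Ev) (r : Fin n → ZMod m) (l : SymSeq) :
    ∑ κ, ∑' i, W i * gainBound e deal d σ Ev G r κ l i ≤ 0 := by
  classical
  set τ := ∑' i, W i with hτ
  have hτ0 : 0 ≤ τ := tsum_nonneg hW.nonneg
  have hbal : ∀ κ : Fin n → ZMod m → ZMod N, ∀ I, ∑' i, W i * balance G (2 * height n) I
      (winning e deal d σ (common r κ l) (∑ k, r k)) i ≤ -δ * ∑' i, if I ≤ i then W i else 0 :=
    fun κ I => hW.tsum_balance_le h0 h1 (winning_gap hM) _ I hG hc hδ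
  -- `v κ` is the contribution the deviator claims, and if it is false, `T y` shifts the value of
  -- the key at `v κ` by `y`; this does not change what the deviator sees and claims
  let v : (Fin n → ZMod m → ZMod N) → ZMod m := fun κ =>
    (claimed e deal d σ (common r κ l) (leafTree d)).1
  let f : ZMod N → (Fin n → ZMod m → ZMod N) → ZMod m → ZMod N := fun y κ =>
    Function.update (κ d) (v κ) (κ d (v κ) + y)
  let T : ZMod N → (Fin n → ZMod m → ZMod N) → (Fin n → ZMod m → ZMod N) := fun y κ =>
    if v κ = r d then κ else Function.update κ d (f y κ)
  have hf : ∀ y κ, v κ ≠ r d → f y κ (r d) = κ d (r d) := fun y κ h =>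
    Function.update_of_ne (Ne.symm h) _ _
  have hcl : ∀ y κ, v κ ≠ r d → claimed e deal d σ (common r (T y κ) l) (leafTree d)
      = claimed e deal d σ (common r κ l) (leafTree d) := fun y κ h => by
    simp only [T, h, if_false]
    exact claimed_update (by omega) (hf y κ h)
  have hv : ∀ y κ, v κ ≠ r d → v (T y κ) = v κ := fun y κ h => congrArg Prod.fst (hcl y κ h)
  refine sum_nonpos_of_shift (T := T) (fun y κ => ?_) fun κ => ?_
  · by_cases h : v κ = r d
    · simp [T, h]
    · have h2 := hv y κ h
      have h3 : v (T y κ) ≠ r d := by rwa [h2]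
      have h4 : T (-y) (T y κ) = Function.update (T y κ) d (f (-y) (T y κ)) := if_neg h3
      have h5 : T y κ = Function.update κ d (f y κ) := if_neg h
      have h6 : f (-y) (T y κ) = κ d := by
        simp only [f, h2]
        rw [h5]
        simp [f]
      rw [h4, h6, h5]
      simp
  · by_cases h : v κ = r d
    · have hT : ∀ y, T y κ = κ := fun y => if_pos h
      simp only [hT]
      refine Finset.sum_nonpos fun _ _ => ?_
      have h' : (claimed e deal d σ (common r κ l) (leafTree d)).1 = r d := h
      by_cases hmem : common r κ l ∈ Ev
      · by_cases hex : ∃ I, Harm e deal d σ (common r κ l) I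
        · simp only [gainBound, hmem, h', hex, if_true, dif_pos]
          refine (hbal κ _).trans (mul_nonpos_of_nonpos_of_nonneg (by linarith)
            (tsum_nonneg fun i => ?_))
          split_ifs
          exacts [hW.nonneg i, le_rfl]
        · simp [gainBound, hmem, h', hex]
      · simp [gainBound, hmem]
    · have hmem : ∀ y, common r (T y κ) l ∈ Ev ↔ common r κ l ∈ Ev := fun y => by
        simp only [T, h, if_false]
        exact (hEv.update_iff r κ l _ h (hf y κ h)).symm
      by_cases hmem0 : common r κ l ∈ Ev
      · -- the tag fits for the shift `y₀` only
        set y₀ := (claimed e deal d σ (common r κ l) (leafTree d)).2 - κ d (v κ) with hy₀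
        have hle : ∀ y, ∑' i, W i * gainBound e deal d σ Ev G r (T y κ) l i
            ≤ if y = y₀ then G * τ else -δ * τ := by
          intro y
          have h2 : (claimed e deal d σ (common r (T y κ) l) (leafTree d)).1 ≠ r d := by
            rw [hcl y κ h]; exact h
          have h3 : T y κ d (claimed e deal d σ (common r (T y κ) l) (leafTree d)).1
              = κ d (v κ) + y := by
            rw [hcl y κ h]
            simp only [T, h, if_false, Function.update_self, f]
            exact Function.update_self _ _ _
          have h4 : (claimed e deal d σ (common r (T y κ) l) (leafTree d)).2 =
              T y κ d (claimed e deal d σ (common r (T y κ) l) (leafTree d)).1 ↔ y = y₀ := by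
            rw [h3, hcl y κ h, hy₀]
            constructor <;> intro h5
            · rw [h5]; ring
            · rw [h5]; ring
          simp only [gainBound, (hmem y).2 hmem0, if_true, h2, if_false, h4]
          split_ifs
          · rw [tsum_mul_right, mul_comm]
          · simpa using hbal (T y κ) 0
        refine (Finset.sum_le_sum fun y _ => hle y).trans ?_
        rw [Finset.sum_ite, Finset.sum_const, Finset.sum_const]
        have hc1 : (Finset.univ.filter fun y => y = y₀).card = 1 := by
          rw [Finset.filter_eq']; simp
        have hc2 : ((Finset.univ.filter fun y => ¬ y = y₀).card : ℝ) = N - 1 := by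
          have h5 := Finset.card_filter_add_card_filter_not (s := (Finset.univ : Finset (ZMod N)))
            (fun y => y = y₀)
          rw [hc1, Finset.card_univ, ZMod.card] at h5
          have h6 := congrArg (Nat.cast (R := ℝ)) h5
          push_cast at h6
          linarith
        rw [hc1, nsmul_eq_mul, nsmul_eq_mul, hc2]
        push_cast
        nlinarith [mul_le_mul_of_nonneg_right hN hτ0]
      · refine Finset.sum_nonpos fun y _ => ?_
        simp [gainBound, hmem y, hmem0]

end Gain

/-! ### The equilibrium -/

section Nash

theorem expectation_sub {α : Type} (p : PMF α) {f g : α → ℝ} {B : ℝ} (hf : ∀ a, |f a| ≤ B)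
    (hg : ∀ a, |g a| ≤ B) :
    expectation p f - expectation p g = expectation p fun a => f a - g a := by
  unfold expectation
  rw [← Summable.tsum_sub (summable_toReal_mul p hf) (summable_toReal_mul p hg)]
  simp only [mul_sub]

theorem expectation_mono {α : Type} (p : PMF α) {f g : α → ℝ} {B : ℝ} (hf : ∀ a, |f a| ≤ B)
    (hg : ∀ a, |g a| ≤ B) (h : ∀ a ∈ p.support, f a ≤ g a) :
    expectation p f ≤ expectation p g := by
  refine Summable.tsum_le_tsum (fun a => ?_) (summable_toReal_mul p hf) (summable_toReal_mul p hg)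
  by_cases ha : a ∈ p.support
  · exact mul_le_mul_of_nonneg_left (h a ha) ENNReal.toReal_nonneg
  · rw [PMF.mem_support_iff, not_not] at ha
    simp [ha]

/-- The marginals of the law of the split number and the symbols that one player sees decrease
slowly: having seen any number of symbols, he believes that the split is far away. -/
def SlowMarginals (η : ℝ) (law : PMF (ℕ × SeqTriple)) : Prop :=
  ∀ c l i, ENNReal.ofReal (1 - η) * law.map (fun L => (L.2 c, L.1)) (l, i)
    ≤ law.map (fun L => (L.2 c, L.1)) (l, i + 1)

theorem SlowMarginals.slowlyDecreasing {η : ℝ} {law : PMF (ℕ × SeqTriple)}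
    (h : SlowMarginals η law) (h1 : η ≤ 1) (c : Fin 3) (l : SymSeq) :
    SlowlyDecreasing η fun i => (law.map (fun L => (L.2 c, L.1)) (l, i)).toReal where
  nonneg _ := ENNReal.toReal_nonneg
  summable := (summable_toReal _).comp_injective (Prod.mk_right_injective l)
  slow i := by
    have := ENNReal.toReal_mono (PMF.apply_ne_top _ _) (h c l i)
    rwa [ENNReal.toReal_mul, ENNReal.toReal_ofReal (by linarith)] at this

/-- The parameters are such that no deviator who can gain at most `G` wants to take the risk of
losing `1`: the value `η` is small compared to the time `D` it takes to stop everybody and to the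
number `m` of candidates, and the number `N` of tags is large. -/
structure Deterring (G η : ℝ) (D m N : ℕ) : Prop where
  nonneg : 0 ≤ G
  pos : 0 < η
  le_one : η ≤ 1
  exists_constants : ∃ (M : ℕ) (δ c : ℝ), 0 < δ ∧ M ≤ m ∧ 1 ≤ c * (M * (1 - η) ^ M) ∧
    (G + 1) * ((2 * D : ℕ) * η + c) ≤ 1 - δ ∧ G ≤ (N - 1) * δ

variable {n m N : ℕ} [NeZero m] [NeZero N] {S : Type} {e : S ≃ ZMod m}
  {law : PMF (ℕ × SeqTriple)} {d : Fin n} {σ : Strategy n S (PlayerShare n m N)}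
  {u : Outcome n S → ℝ} {G Δ η : ℝ}

theorem expectation_gainBound_nonpos {deal : S → PMF (Fin n → PlayerShare n m N)} (hn : 3 ≤ n)
    (hpar : Deterring G η (height n) m N) (hslow : SlowMarginals η law)
    {Ev : Set (Fin n → PlayerShare n m N)} (hEv : Observable e deal d σ Ev) :
    expectation law (fun L => ∑ r, ∑ κ, gainBound e deal d σ Ev G r κ (L.2 (cls d)) L.1) ≤ 0 := by
  obtain ⟨M, δ, c, hδ0, hM, hc, hδ, hN⟩ := hpar.exists_constants
  set h : SymSeq × ℕ → ℝ := fun q => ∑ r, ∑ κ, gainBound e deal d σ Ev G r κ q.1 q.2 with hh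
  have hb : ∀ q, |h q| ≤ ∑ _r : Fin n → ZMod m, ∑ _κ : Fin n → ZMod m → ZMod N, (G + 1) := by
    intro q
    refine (Finset.abs_sum_le_sum_abs _ _).trans (Finset.sum_le_sum fun r _ => ?_)
    refine (Finset.abs_sum_le_sum_abs _ _).trans (Finset.sum_le_sum fun κ _ => ?_)
    exact abs_gainBound_le hpar.nonneg _
  have h1 := expectation_map law (fun L => (L.2 (cls d), L.1)) hb
  simp only [hh] at h1
  rw [← h1]
  change expectation _ h ≤ 0
  unfold expectation
  rw [Summable.tsum_prod (summable_toReal_mul _ hb)]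
  refine tsum_nonpos fun l => ?_
  have hW := hslow.slowlyDecreasing hpar.le_one (cls d) l
  have hsum : ∀ r κ, Summable fun i => (law.map (fun L => (L.2 (cls d), L.1)) (l, i)).toReal *
      gainBound e deal d σ Ev G r κ l i := fun r κ => by
    refine Summable.of_norm_bounded (hW.summable.mul_right (G + 1)) fun i => ?_
    rw [Real.norm_eq_abs, abs_mul, abs_of_nonneg ENNReal.toReal_nonneg]
    exact mul_le_mul_of_nonneg_left (abs_gainBound_le hpar.nonneg _) ENNReal.toReal_nonneg
  simp only [hh, Finset.mul_sum]
  rw [Summable.tsum_finsetSum fun r _ => summable_sum fun κ _ => hsum r κ]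
  refine Finset.sum_nonpos fun r _ => ?_
  rw [Summable.tsum_finsetSum fun κ _ => hsum r κ]
  exact sum_gainBound_nonpos hn hW hpar.pos hpar.le_one hpar.nonneg hδ0 hM hc hδ hN hEv r l

theorem exists_abs_le [Finite S] (u : Outcome n S → ℝ) : ∃ B, ∀ o, |u o| ≤ B := by
  obtain ⟨B, hB⟩ := (Set.finite_range fun o => |u o|).bddAbove
  exact ⟨B, fun o => hB ⟨o, rfl⟩⟩

theorem abs_indicator_le {α : Type} (s : Set α) {f : α → ℝ} {B : ℝ} (hf : ∀ a, |f a| ≤ B) (a : α) :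
    |s.indicator f a| ≤ B := by
  by_cases ha : a ∈ s
  · rw [Set.indicator_of_mem ha]; exact hf a
  · rw [Set.indicator_of_notMem ha, abs_zero]
    exact (abs_nonneg _).trans (hf a)

/-- On every observable event, deviating does not pay. -/
theorem expect_indicator_le [NeZero n] [Fintype S] (hn : 3 ≤ n)
    (hpar : Deterring G η (height n) m N)
    (hslow : SlowMarginals η law) (hsplit : ∀ L ∈ law.support, Splits L) (hu : HasGap u d G Δ)
    {Ev : Set (Fin n → PlayerShare n m N)} (hEv : Observable e (dealer n N e law) d σ Ev) :
    (protocol e (dealer n N e law)).expect (fun s x => Ev.indicator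
        (fun x => u ((protocol e (dealer n N e law)).devOutcome d σ s x)) x) ≤
      (protocol e (dealer n N e law)).expect (fun s x => Ev.indicator
        (fun x => u ((protocol e (dealer n N e law)).outcome s x)) x) := by
  obtain ⟨B, hB⟩ := exists_abs_le u
  obtain ⟨w, hw, hexp⟩ := expect_dealer (n := n) (N := N) e law
  rw [hexp _ B fun s x => abs_indicator_le _ (fun _ => hB _) _,
    hexp _ B fun s x => abs_indicator_le _ (fun _ => hB _) _]
  refine mul_le_mul_of_nonneg_left ?_ hw.le
  rw [← sub_nonpos]
  have hsum : ∀ {B : ℝ} {f : (Fin n → ZMod m) → (Fin n → ZMod m → ZMod N) → ℝ},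
      (∀ r κ, |f r κ| ≤ B) → |∑ r, ∑ κ, f r κ|
        ≤ ∑ _r : Fin n → ZMod m, ∑ _κ : Fin n → ZMod m → ZMod N, B := fun hf =>
    (Finset.abs_sum_le_sum_abs _ _).trans (Finset.sum_le_sum fun r _ =>
      (Finset.abs_sum_le_sum_abs _ _).trans (Finset.sum_le_sum fun κ _ => hf r κ))
  rw [expectation_sub law (fun L => hsum fun r κ => abs_indicator_le _ (fun _ => hB _) _)
    (fun L => hsum fun r κ => abs_indicator_le _ (fun _ => hB _) _)]
  have hle := expectation_gainBound_nonpos hn hpar hslow hEv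
  have hscale : expectation law (fun L => ∑ r, ∑ κ,
        Δ * gainBound e (dealer n N e law) d σ Ev G r κ (L.2 (cls d)) L.1) ≤ 0 := by
    have : expectation law (fun L => ∑ r, ∑ κ,
        Δ * gainBound e (dealer n N e law) d σ Ev G r κ (L.2 (cls d)) L.1)
      = Δ * expectation law (fun L => ∑ r, ∑ κ,
        gainBound e (dealer n N e law) d σ Ev G r κ (L.2 (cls d)) L.1) := by
      unfold expectation
      rw [← tsum_mul_left]
      refine tsum_congr fun L => ?_
      simp only [← Finset.mul_sum]
      ring
    rw [this]
    exact mul_nonpos_of_nonneg_of_nonpos hu.pos.le hle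
  refine le_trans ?_ hscale
  have hX := fun (f : S → (Fin n → PlayerShare n m N) → Outcome n S) (L : ℕ × SeqTriple) =>
    hsum (f := fun r κ => Ev.indicator (fun x => u (f (e.symm (∑ k, r k + (L.1 : ZMod m))) x))
      (shares r κ L.2)) fun r κ => abs_indicator_le _ (fun _ => hB _) _
  have hY := fun L : ℕ × SeqTriple =>
    hsum (B := Δ * (G + 1)) (f := fun r κ =>
      Δ * gainBound e (dealer n N e law) d σ Ev G r κ (L.2 (cls d)) L.1) fun r κ => by
        rw [abs_mul, abs_of_pos hu.pos]
        exact mul_le_mul_of_nonneg_left (abs_gainBound_le hpar.nonneg _) hu.pos.le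
  refine expectation_mono law (fun L => ((abs_sub _ _).trans (add_le_add (hX _ L) (hX _ L))).trans
    (le_max_left _ _)) (fun L => (hY L).trans (le_max_right _ _)) fun L hL => ?_
  simp only [← Finset.sum_sub_distrib]
  refine Finset.sum_le_sum fun r _ => Finset.sum_le_sum fun κ _ => ?_
  refine le_trans (le_of_eq ?_) (indicator_gain_le hn hu (hsplit L hL) hEv)
  by_cases hx : shares r κ L.2 ∈ Ev
  · rw [Set.indicator_of_mem hx, Set.indicator_of_mem hx, Set.indicator_of_mem hx]
    rfl
  · rw [Set.indicator_of_notMem hx, Set.indicator_of_notMem hx, Set.indicator_of_notMem hx,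
      sub_zero]

variable {deal : S → PMF (Fin n → PlayerShare n m N)}

theorem observable_univ : Observable e deal d σ Set.univ where
  common_iff _ _ _ _ _ := by simp
  update_iff _ _ _ _ _ _ := by simp

section Switch

variable {t : ℕ} {r : Fin n → ZMod m} {κ : Fin n → ZMod m → ZMod N} {l : SymSeq}

/-- As long as the deviator follows the protocol, he claims his true contribution. -/
theorem claimed_switchAt (hn : 2 ≤ n) (x : Fin n → PlayerShare n m N) (ht : endTime n ≤ t) :
    claimed e deal d ((protocol e deal).switchAt d t σ) x (leafTree d)
      = ((x d).part, (x d).tag) := by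
  have h0 := (isLeaf_leafTree d).idx_ne_zero hn
  have h1 := upTime_lt_endTime h0
  rw [← claimed_followDev (e := e) (deal := deal) hn (isLeaf_leafTree d)]
  unfold claimed
  rw [← received_run (Nat.lt_succ_self _) (par_ne h0).symm,
    ← received_run (Nat.lt_succ_self _) (par_ne h0).symm, Protocol.devHist_followDev]
  congr 2
  exact congrFun (Protocol.devHist_switchAt (P := protocol e deal) (by omega)) _

theorem lt_endTime_of_claimed_ne (hn : 2 ≤ n)
    (h : (claimed e deal d ((protocol e deal).switchAt d t σ) (common r κ l) (leafTree d)).1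
      ≠ r d) : t < endTime n := by
  by_contra ht
  rw [claimed_switchAt hn _ (not_lt.1 ht)] at h
  exact h rfl

theorem lt_of_harm (hn : 3 ≤ n) {i : ℕ}
    (h : Harm e deal d ((protocol e deal).switchAt d t σ) (common r κ l) i) :
    t < endTime n + i := by
  by_contra ht
  obtain ⟨p, -, hok⟩ := h
  rw [Protocol.devHist_switchAt (P := protocol e deal) (not_lt.1 ht)] at hok
  exact hok (ok_hist hn (fun k => by unfold common; rw [shares_key]; rfl) (fun _ _ _ _ => rfl) p)

theorem observable_view (hn : 3 ≤ n) (t : ℕ) (a : PlayerShare n m N) (h : History n) :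
    Observable e deal d ((protocol e deal).switchAt d t σ)
      ((protocol e deal).View d t a h) where
  common_iff r κ L hL hdev := by
    have ht : t + 1 ≤ endTime n + L.1 := by
      rcases hdev with hdev | hdev
      · have := lt_endTime_of_claimed_ne (by omega) hdev
        omega
      · exact lt_of_harm hn hdev
    have hsame : SameUntil d L.1 (common r κ (L.2 (cls d))) (shares r κ L.2) :=
      sameUntil_common hL
    have hhist := hsame.devHist_eq (e := e) (deal := deal)
      (σ := (protocol e deal).followDev d) ht
    rw [Protocol.devHist_followDev, Protocol.devHist_followDev] at hhist
    unfold Protocol.View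
    rw [Set.mem_ofPred_eq, Set.mem_ofPred_eq, hhist, hsame.dev]
  update_iff r κ l f hdev hf := by
    have ht := lt_endTime_of_claimed_ne (by omega) hdev
    have hd : common r (Function.update κ d f) l d = common r κ l d :=
      common_update_apply (by omega) hf
    have hhist := devHist_eq_of_endTime (e := e) (deal := deal)
      (σ := (protocol e deal).followDev d) hd (fun _ => rfl) (tag_common_update hf)
      (show t + 1 ≤ endTime n by omega)
    rw [Protocol.devHist_followDev, Protocol.devHist_followDev] at hhist
    unfold Protocol.View
    rw [Set.mem_ofPred_eq, Set.mem_ofPred_eq, hhist, hd]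

end Switch

theorem isEverlastingNash [NeZero n] [Fintype S] (hn : 3 ≤ n) {U : ℝ} (hU : 1 ≤ U)
    (hpar : Deterring (U - 1) η (height n) m N) (hslow : SlowMarginals η law)
    (hsplit : ∀ L ∈ law.support, Splits L) {u : Utility n S} (hu : u.LearningPreferring)
    (hratio : u.ratio ≤ U) : (protocol e (dealer n N e law)).IsEverlastingNash u := by
  have : Nonempty S := ⟨e.symm 0⟩
  refine ⟨fun j σ => ?_, fun j t a h hpos σ => ?_⟩
  · obtain ⟨Δ, hΔ⟩ := exists_hasGap hu hU hratio j
    have := expect_indicator_le (e := e) (σ := σ) hn hpar hslow hsplit hΔ observable_univ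
    simpa only [Set.indicator_univ] using this
  · obtain ⟨Δ, hΔ⟩ := exists_hasGap hu hU hratio j
    exact div_le_div_of_nonneg_right
      (expect_indicator_le (e := e) hn hpar hslow hsplit hΔ (observable_view hn t a h)) hpos.le

end Nash

/-! ### Costs -/

section Costs

theorem tsum_bind_mul_le {α β : Type} (p : PMF α) (q : α → PMF β) (f : β → ℝ≥0∞)
    (g : α → ℝ≥0∞)
    (h : ∀ a ∈ p.support, ∀ b ∈ (q a).support, f b ≤ g a) :
    ∑' b, p.bind q b * f b ≤ ∑' a, p a * g a := by
  calc ∑' b, p.bind q b * f b = ∑' b, ∑' a, p a * (q a b * f b) := by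
        refine tsum_congr fun b => ?_
        rw [PMF.bind_apply, ← ENNReal.tsum_mul_right]
        simp only [mul_assoc]
    _ = ∑' a, p a * ∑' b, q a b * f b := by
        rw [ENNReal.tsum_comm]
        simp only [ENNReal.tsum_mul_left]
    _ ≤ ∑' a, p a * ∑' b, q a b * g a := by
        refine ENNReal.tsum_le_tsum fun a => ?_
        by_cases ha : a ∈ p.support
        · refine mul_le_mul_right (ENNReal.tsum_le_tsum fun b => ?_) _
          by_cases hb : b ∈ (q a).support
          · exact mul_le_mul_right (h a ha b hb) _
          · rw [PMF.mem_support_iff, not_not] at hb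
            simp [hb]
        · rw [PMF.mem_support_iff, not_not] at ha
          simp [ha]
    _ = _ := by simp only [ENNReal.tsum_mul_right, PMF.tsum_coe, one_mul]

variable {n m N : ℕ} [NeZero m] [NeZero N] {S : Type} {e : S ≃ ZMod m}
  {deal : S → PMF (Fin n → PlayerShare n m N)} {x : Fin n → PlayerShare n m N}

theorem sum_length_treeSend_le (b : Bool) (p : Fin n) (a : PlayerShare n m N) (h : History n) :
    ∑ k, (treeSend b p a h k).length ≤ (if h.length = upTime b p then Nat.size (m * N) else 0) +
      (if h.length = downTime b p then 2 * Nat.size (m * N) else 0) := by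
  classical
  have h1 : ∀ k, (treeSend b p a h k).length
      ≤ (if k = par b p then (if h.length = upTime b p then Nat.size (m * N) else 0) else 0) +
        (if k ∈ kids b p then
          (if h.length = downTime b p then Nat.size (m * N) else 0) else 0) := by
    intro k
    unfold treeSend
    split_ifs with h1 h2 h3 h4 h5 h6 h7 h8 h9
    all_goals first
      | exact (length_enc_le _).trans (by omega)
      | exact Nat.zero_le _
      | (exfalso; exact (by tauto))
      | (exfalso; exact h2 (mem_kids.1 h1.1).2.symm)
  refine (Finset.sum_le_sum fun k _ => h1 k).trans ?_
  rw [Finset.sum_add_distrib, Finset.sum_ite_eq' Finset.univ (par b p), if_pos (Finset.mem_univ _),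
    Finset.sum_ite_mem, Finset.univ_inter, Finset.sum_const, smul_eq_mul]
  have := card_kids_le b p
  split_ifs
  all_goals nlinarith

theorem sum_length_symbol_le (p : Fin n) (l : Msg) (hl : l.length ≤ 3) (P : Fin n → Prop)
    [DecidablePred P] (hP : ∀ k, P k → Adj p k) :
    ∑ k, (if P k then l else []).length ≤ 30 := by
  classical
  have h1 : ∀ k, (if P k then l else []).length ≤ if Adj p k then 3 else 0 := by
    intro k
    split_ifs with h2 h3
    · exact hl
    · exact absurd (hP k h2) h3
    · exact Nat.zero_le _
    · exact Nat.zero_le _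
  refine (Finset.sum_le_sum fun k _ => h1 k).trans ?_
  rw [← Finset.sum_filter, Finset.sum_const, smul_eq_mul]
  have := card_adj_le p
  omega

/-- The number of bits sent in each time step, when everybody has stopped after the `i`-th
symbols. -/
theorem sum_length_sent_le (p : Fin n) {i : ℕ}
    (hhalt : ∀ T, endTime n + i < T → ¬ Ok p (x p) ((protocol e deal).hist x T p)) (t : ℕ) :
    ∑ k, ((protocol e deal).sent x t p k).length ≤
      ∑ b : Bool, ((if t = upTime b p then Nat.size (m * N) else 0) +
        (if t = downTime b p then 2 * Nat.size (m * N) else 0)) +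
      if t ∈ Finset.Icc (endTime n) (endTime n + i) then 30 else 0 := by
  classical
  have hlen : ((protocol e deal).hist x t p).length = t :=
    Protocol.length_hist (P := protocol e deal) t p
  have hsent : ∀ k, (protocol e deal).sent x t p k
      = (player e p).send (x p) ((protocol e deal).hist x t p) k := fun _ => rfl
  have htree := fun b => sum_length_treeSend_le b p (x p) ((protocol e deal).hist x t p)
  simp only [hlen] at htree
  simp only [hsent, Fintype.sum_bool]
  by_cases ht : t < endTime n
  · by_cases ht' : t < 2 * height n
    · simp only [player, hlen, ht', if_true]
      have := htree false
      omega
    · simp only [player, hlen, ht', if_false, ht, if_true]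
      have := htree true
      omega
  · by_cases hi : t ≤ endTime n + i
    · have ht' : ¬ t < 2 * height n := by unfold endTime at ht; omega
      simp only [player, hlen, ht', ht, if_false]
      rw [if_pos (Finset.mem_Icc.2 ⟨by omega, hi⟩)]
      refine (sum_length_symbol_le p _ (length_code_le _) _ fun k hk => hk.2).trans ?_
      omega
    · simp only [send_of_not_ok (e := e) (hlen.symm ▸ not_lt.1 ht) (hhalt t (by omega))]
      simp

theorem bits_le (p : Fin n) {i : ℕ}
    (hhalt : ∀ T, endTime n + i < T → ¬ Ok p (x p) ((protocol e deal).hist x T p)) :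
    (protocol e deal).bits x p ≤ (6 * Nat.size (m * N) + 30 : ℕ) + 30 * (i : ℝ≥0∞) := by
  classical
  set z := Nat.size (m * N) with hz
  have h1 : ∀ t, ∑ k ∈ Finset.univ.erase p, (((protocol e deal).sent x t p k).length : ℝ≥0∞) ≤
      ∑ b : Bool, ((if t = upTime b p then (z : ℝ≥0∞) else 0) +
        (if t = downTime b p then 2 * (z : ℝ≥0∞) else 0)) +
      if t ∈ Finset.Icc (endTime n) (endTime n + i) then (30 : ℝ≥0∞) else 0 := by
    intro t
    refine (Finset.sum_le_sum_of_subset (Finset.subset_univ _)).trans ?_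
    exact_mod_cast sum_length_sent_le p hhalt t
  unfold Protocol.bits
  refine (ENNReal.tsum_le_tsum h1).trans (le_of_eq ?_)
  simp only [Fintype.sum_bool]
  rw [ENNReal.tsum_add, ENNReal.tsum_add, ENNReal.tsum_add, ENNReal.tsum_add, tsum_ite_eq,
    tsum_ite_eq, tsum_ite_eq, tsum_ite_eq, tsum_eq_sum (s := Finset.Icc (endTime n) (endTime n + i))
    (fun t ht => if_neg ht), Finset.sum_congr rfl (fun t ht => if_pos ht), Finset.sum_const,
    Nat.card_Icc, show endTime n + i + 1 - endTime n = i + 1 by omega, nsmul_eq_mul]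
  push_cast
  ring

theorem latency_le {i : ℕ}
    (hhalt : ∀ p T, endTime n + i < T → ¬ Ok p (x p) ((protocol e deal).hist x T p)) :
    (protocol e deal).latency x ≤ (4 * height n + 1 : ℕ) + 1 * (i : ℝ≥0∞) := by
  have hlen : ∀ t p, ((protocol e deal).hist x t p).length = t := fun t p =>
    Protocol.length_hist (P := protocol e deal) t p
  have hfin : (protocol e deal).Finished x (endTime n + i + 1) := by
    refine ⟨fun p => ⟨_, le_rfl, ?_⟩, fun t ht p k _ => ?_⟩
    · have h1 : ¬ (endTime n + i + 1 < endTime n) := by omega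
      simp [Protocol.out, player, hlen, hhalt p _ (Nat.lt_succ_self _), h1]
    · exact send_of_not_ok (by rw [hlen]; omega) (hhalt p t (by omega))
  refine (iInf₂_le _ hfin).trans (le_of_eq ?_)
  unfold endTime
  push_cast
  ring

variable {law : PMF (ℕ × SeqTriple)}

theorem not_ok_shares (hn : 3 ≤ n) {L : ℕ × SeqTriple} (hL : Splits L) (r : Fin n → ZMod m)
    (κ : Fin n → ZMod m → ZMod N) (p : Fin n) (T : ℕ) (hT : endTime n + L.1 < T) :
    ¬ Ok p (shares r κ L.2 p) ((protocol e deal).hist (shares r κ L.2) T p) :=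
  not_ok_hist hn (fun k => by rw [shares_key]; rfl) (fun i hi p q => hL.1 i hi _ _)
    (fun p q h => hL.2 _ _ h) p hT

/-- A cost that grows linearly with the split number. -/
theorem tsum_dealer_le [NeZero n] (hsplit : ∀ L ∈ law.support, Splits L) (s : S)
    {f : (Fin n → PlayerShare n m N) → ℝ≥0∞} {a b E : ℝ≥0∞}
    (hf : ∀ L, Splits L → ∀ r κ, f (shares r κ L.2) ≤ a + b * L.1)
    (hE : ∑' L, law L * L.1 ≤ E) :
    ∑' x, dealer n N e law s x * f x ≤ a + b * E := by
  refine (tsum_bind_mul_le law _ f (fun L => a + b * L.1) fun L hL x hx => ?_).trans ?_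
  · simp only [PMF.mem_support_bind_iff, PMF.mem_support_map_iff] at hx
    obtain ⟨r, -, κ, -, rfl⟩ := hx
    exact hf L (hsplit L hL) r κ
  · simp only [mul_add]
    rw [ENNReal.tsum_add, ENNReal.tsum_mul_right, law.tsum_coe, one_mul]
    have : ∀ L : ℕ × SeqTriple, law L * (b * (L.1 : ℝ≥0∞)) = b * (law L * L.1) := fun L => by ring
    simp only [this, ENNReal.tsum_mul_left]
    gcongr

theorem allLearn [NeZero n] (hn : 3 ≤ n) (hsplit : ∀ L ∈ law.support, Splits L) :
    (protocol e (dealer n N e law)).AllLearn := by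
  intro s x hx
  obtain ⟨L, hL, r, κ, hr, rfl⟩ := mem_support_dealer hx
  rw [outcome_shares hn (hsplit L hL), hr, Equiv.symm_apply_apply]
  exact Set.eq_univ_of_forall fun _ => rfl

end Costs

/-! ### The parameters -/

theorem one_le_log {n : ℕ} (hn : 3 ≤ n) : 1 ≤ Real.log n := by
  rw [Real.le_log_iff_exp_le (by positivity)]
  have := Real.exp_one_lt_d9
  have : (3 : ℝ) ≤ n := by exact_mod_cast hn
  linarith

theorem height_le {n : ℕ} (hn : 3 ≤ n) : (height n : ℝ) ≤ Real.log n / Real.log 2 := by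
  rw [le_div_iff₀ (Real.log_pos one_lt_two), ← Real.log_pow]
  refine Real.log_le_log (by positivity) ?_
  exact_mod_cast Nat.pow_log_le_self 2 (by omega)

theorem size_le {k : ℕ} (hk : k ≠ 0) : (Nat.size k : ℝ) ≤ 1 + Real.log k / Real.log 2 := by
  have h1 : 2 ^ (Nat.size k - 1) ≤ k := Nat.lt_size.1 (by
    have := Nat.size_pos.2 (Nat.pos_of_ne_zero hk)
    omega)
  have h2 : ((Nat.size k - 1 : ℕ) : ℝ) ≤ Real.log k / Real.log 2 := by
    rw [le_div_iff₀ (Real.log_pos one_lt_two), ← Real.log_pow]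
    exact Real.log_le_log (by positivity) (by exact_mod_cast h1)
  have h3 : (Nat.size k : ℝ) ≤ ((Nat.size k - 1 : ℕ) : ℝ) + 1 := by
    exact_mod_cast (by omega : Nat.size k ≤ Nat.size k - 1 + 1)
  linarith

end

end RationalSecretSharing

open RationalSecretSharing in
theorem theorem1 (U K : ℝ) (hU : 1 ≤ U) :
    ∃ C : ℝ, ∀ (n : ℕ) (S : Type) [Fintype S],
      3 ≤ n → U < Fintype.card S → (Fintype.card S : ℝ) ≤ K * n →
      ∃ P : Protocol n S,
        P.Secrecy ∧ P.AllLearn ∧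
        (∀ u : Utility n S, u.LearningPreferring → u.ratio ≤ U → P.IsEverlastingNash u) ∧
        (∀ (s : S) (i : Fin n), P.expectedBits s i ≤ ENNReal.ofReal (C * Real.log n)) ∧
        (∀ s : S, P.expectedLatency s ≤ ENNReal.ofReal (C * Real.log n)) := by
  obtain ⟨M, N, c, δ, κ, hc0, hc1, hδ, hN, hM, hUN, hD⟩ := exists_constants hU
  have hlog2 : 0 < Real.log 2 := Real.log_pos one_lt_two
  set A : ℝ := 1 + (|Real.log (K * N)| + 1) / Real.log 2 with hA
  have hA0 : 0 ≤ A := by positivity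
  set E : ℝ := 8 / (c * Real.log 2) with hE
  have hE0 : 0 ≤ E := by positivity
  refine ⟨(6 * A + 30 + 30 * E) + (4 / Real.log 2 + 1 + E), fun n S _ hn hUS hSK => ?_⟩
  set m := Fintype.card S with hm
  have hm1 : (1 : ℝ) < m := hU.trans_lt hUS
  have hm0 : 0 < m := by
    have : (0 : ℝ) < m := by linarith
    exact_mod_cast this
  have hn0 : (0 : ℝ) < n := by exact_mod_cast (by omega : 0 < n)
  have hK : 0 < K := by
    by_contra hK
    have := mul_nonpos_of_nonpos_of_nonneg (not_lt.1 hK) hn0.le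
    linarith
  have : NeZero n := ⟨by omega⟩
  have : NeZero m := ⟨hm0.ne'⟩
  have : NeZero N := ⟨hN.ne'⟩
  have e : S ≃ ZMod m := Fintype.equivOfCardEq (by rw [ZMod.card])
  have hh : 1 ≤ height n := Nat.log_pos one_lt_two (by omega)
  have hh' : (1 : ℝ) ≤ height n := by exact_mod_cast hh
  set η : ℝ := c / height n with hη
  have hη0 : 0 < η := by positivity
  have hη1 : η ≤ 1 := by rw [hη, div_le_one (by linarith)]; linarith
  obtain ⟨law, hsplit, hslow, hmean⟩ := exists_splitLaw hη0 hη1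
  have hlog := one_le_log hn
  have hheight := height_le hn
  have h8 : 8 / η ≤ E * Real.log n := by
    rw [hη, hE, div_div_eq_mul_div, div_mul_eq_mul_div, div_le_div_iff₀ hc0 (by positivity)]
    rw [le_div_iff₀ hlog2] at hheight
    nlinarith
  have h80 : 0 ≤ 8 / η := by positivity
  have hsize : (Nat.size (m * N) : ℝ) ≤ A * Real.log n := by
    have hmN : m * N ≠ 0 := (Nat.mul_pos hm0 hN).ne'
    have hN' : (0 : ℝ) < N := by exact_mod_cast hN
    have h1 : Real.log ((m * N : ℕ) : ℝ) ≤ (|Real.log (K * N)| + 1) * Real.log n := by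
      have h2 : ((m * N : ℕ) : ℝ) ≤ K * N * n := by
        push_cast
        nlinarith
      refine (Real.log_le_log (by exact_mod_cast Nat.pos_of_ne_zero hmN) h2).trans ?_
      rw [Real.log_mul (by positivity) (by positivity)]
      have h3 := le_abs_self (Real.log (K * N))
      have h4 := abs_nonneg (Real.log (K * N))
      nlinarith
    refine (size_le hmN).trans ?_
    rw [hA, add_mul, one_mul, div_mul_eq_mul_div]
    exact add_le_add hlog (div_le_div_of_nonneg_right h1 hlog2.le)
  refine ⟨protocol e (dealer n N e law), secrecy_dealer e law, allLearn hn hsplit,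
    fun u hu hratio => ?_, fun s i => ?_, fun s => ?_⟩
  · refine isEverlastingNash hn hU ⟨by linarith, hη0, hη1, M, δ, κ, hδ, hM m hUS, ?_⟩ hslow
      hsplit hu hratio
    exact ⟨(hD _ hh).1, (hD _ hh).2, hUN⟩
  · refine (tsum_dealer_le hsplit s (fun L hL r κ => bits_le i (not_ok_shares hn hL r κ i))
      hmean).trans ?_
    rw [← ENNReal.ofReal_natCast, show (30 : ℝ≥0∞) = ENNReal.ofReal 30 by norm_num,
      ← ENNReal.ofReal_mul (by norm_num), ← ENNReal.ofReal_add (by positivity) (by positivity)]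
    refine ENNReal.ofReal_le_ofReal ?_
    push_cast
    have : 0 ≤ (4 / Real.log 2 + 1 + E) * Real.log n := by positivity
    nlinarith
  · refine (tsum_dealer_le hsplit s (fun L hL r κ => latency_le (not_ok_shares hn hL r κ))
      hmean).trans ?_
    rw [← ENNReal.ofReal_natCast, one_mul, ← ENNReal.ofReal_add (by positivity) (by positivity)]
    refine ENNReal.ofReal_le_ofReal ?_
    push_cast
    have h1 : 0 ≤ (6 * A + 30 + 30 * E) * Real.log n := by positivity
    have h2 : 4 / Real.log 2 * Real.log n = 4 * (Real.log n / Real.log 2) := by ring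
    nlinarith
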